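/- Let $\mathbb K=\mathbb R$ or $\mathbb C$ and let $n\ge 5$. A twisted $n$-gon is a map $v:\mathbb Z\to\mathbb P^2(\mathbb K)$ with $v_{i+n}=M v_i$ for all $i$ and a fixed $M\in \mathrm{PGL}_3(\mathbb K)$ (the monodromy); it is closed if $M=1$. We consider polygons any four consecutive vertices of which are in general position (no three collinear), which is exactly the condition for the corner invariants $x_1,\dots,x_{2n}$ (indices mod $2n$) to be defined: $$x_{2i-1}=\big[v_{i-2},\,v_{i-1},\,(v_{i-2}v_{i-1})\cap(v_iv_{i+1}),\,(v_{i-2}v_{i-1})\cap(v_{i+1}v_{i+2})\big],$$ $$x_{2i}=\big[v_{i+2},\,v_{i+1},\,(v_{i+2}v_{i+1})\cap(v_iv_{i-1}),\,(v_{i+2}v_{i+1})\cap(v_{i-1}v_{i-2})\big],$$ where $[t_1,t_2,t_3,t_4]=\frac{(t_1-t_2)(t_3-t_4)}{(t_1-t_3)(t_2-t_4)}$ in an affine parameter on the line. The corner invariants are coordinates on the space $\mathcal P_n\subset\mathbb K^{2n}$ of twisted $n$-gons modulo projective equivalence; let $\mathcal C_n\subset\mathcal P_n$ be the subvariety of (classes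 of) closed $n$-gons. Equip $\mathcal P_n$ with the Poisson bracket $\{x_i,x_{i+2}\}=(-1)^i x_ix_{i+2}$, all other brackets of coordinate functions being zero, and let $X_F$, with $X_F(g)=\{F,g\}$, be the Hamiltonian vector field of $F$. The monodromy invariants are the polynomials $O_1,\dots,O_{[n/2]},O_n,E_1,\dots,E_{[n/2]},E_n$, where $O_n=x_1x_3\cdots x_{2n-1}$, $E_n=x_2x_4\cdots x_{2n}$ and, for $1\le k\le[n/2]$, with $X_i=x_{i-1}x_ix_{i+1}$, $$O_k=\sum (-1)^t\,X_{i_1}\cdots X_{i_s}\,x_{j_1}\cdots x_{j_t},$$ the sum being over all products of $s+t=k$ distinct factors, with $i_1,\dots,i_s$ even and $j_1,\dots,j_t$ odd, that pairwise Poisson commute; $E_k$ is defined in the same way with even and odd interchanged. Then for every monodromy invariant $F$ the Hamiltonian vector field $X_F$ is tangent to $\mathcal C_n$: for every $x\in\mathcal C_n$ the vector $X_F(x)$ is the velocity at $x$ of an analytic arc in $\mathbb K^{2n}$ that passes through $x$ and is contained in $\mathcal C_n$. -/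

import Mathlib

open scoped LinearAlgebra.Projectivization MatrixGroups Topology

noncomputable section

namespace Pentagram

/-! ### Twisted polygons and their corner invariants -/

section Polygons

variable {𝕜 : Type*} [Field 𝕜]

/-- `v` is a twisted `n`-gon in the projective plane with monodromy `M`. -/
def IsTwistedPolygon (n : ℕ) (v : ℤ → ℙ 𝕜 (Fin 3 → 𝕜)) (M : PGL(Fin 3, 𝕜)) : Prop :=
  ∀ i : ℤ, v (i + n) = M • v i

/-- Any four consecutive vertices are in general position (no three of them are collinear).
This is exactly the condition under which all corner invariants are defined. -/
def InGeneralPosition (v : ℤ → ℙ 𝕜 (Fin 3 → 𝕜)) : Prop :=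
  ∀ i : ℤ,
    Projectivization.Independent ![v i, v (i + 1), v (i + 2)] ∧
    Projectivization.Independent ![v i, v (i + 1), v (i + 3)] ∧
    Projectivization.Independent ![v i, v (i + 2), v (i + 3)] ∧
    Projectivization.Independent ![v (i + 1), v (i + 2), v (i + 3)]

/-- The line through two points of the projective plane, as a subspace of `𝕜³`. -/
def lineThrough (p q : ℙ 𝕜 (Fin 3 → 𝕜)) : Submodule 𝕜 (Fin 3 → 𝕜) :=
  p.submodule ⊔ q.submodule

/-- `r` is the (inverse) cross ratio
`[A, B, C, D] = (t₁ - t₂) (t₃ - t₄) / ((t₁ - t₃) (t₂ - t₄))` of four collinear points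
(given as one-dimensional subspaces of `𝕜³`), where `t` is an affine parameter on their line:
`t` is the parameter of the point spanned by `a + t b`. -/
def IsInvCrossRatio (A B C D : Submodule 𝕜 (Fin 3 → 𝕜)) (r : 𝕜) : Prop :=
  ∃ (a b : Fin 3 → 𝕜) (t₁ t₂ t₃ t₄ : 𝕜),
    LinearIndependent 𝕜 ![a, b] ∧
    A = 𝕜 ∙ (a + t₁ • b) ∧ B = 𝕜 ∙ (a + t₂ • b) ∧
    C = 𝕜 ∙ (a + t₃ • b) ∧ D = 𝕜 ∙ (a + t₄ • b) ∧
    t₁ ≠ t₃ ∧ t₂ ≠ t₄ ∧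
    r = ((t₁ - t₂) * (t₃ - t₄)) / ((t₁ - t₃) * (t₂ - t₄))

/-- `x` is the `2n`-tuple of corner invariants of `v`; the indices are cyclic modulo `2n`. -/
def HasCornerInvariants (n : ℕ) (v : ℤ → ℙ 𝕜 (Fin 3 → 𝕜)) (x : ZMod (2 * n) → 𝕜) : Prop :=
  ∀ i : ℤ,
    IsInvCrossRatio (v (i - 2)).submodule (v (i - 1)).submodule
      (lineThrough (v (i - 2)) (v (i - 1)) ⊓ lineThrough (v i) (v (i + 1)))
      (lineThrough (v (i - 2)) (v (i - 1)) ⊓ lineThrough (v (i + 1)) (v (i + 2)))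
      (x ((2 * i - 1 : ℤ) : ZMod (2 * n))) ∧
    IsInvCrossRatio (v (i + 2)).submodule (v (i + 1)).submodule
      (lineThrough (v (i + 2)) (v (i + 1)) ⊓ lineThrough (v i) (v (i - 1)))
      (lineThrough (v (i + 2)) (v (i + 1)) ⊓ lineThrough (v (i - 1)) (v (i - 2)))
      (x ((2 * i : ℤ) : ZMod (2 * n)))

variable (𝕜) in
/-- The space `𝒫ₙ` of twisted `n`-gons modulo projective equivalence, in the corner
coordinates. -/
def twistedSpace (n : ℕ) : Set (ZMod (2 * n) → 𝕜) :=
  {x | ∃ v M, IsTwistedPolygon n v M ∧ InGeneralPosition v ∧ HasCornerInvariants n v x}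

variable (𝕜) in
/-- The subvariety `𝒞ₙ ⊆ 𝒫ₙ` of closed `n`-gons (those with trivial monodromy), in the corner
coordinates. -/
def closedSpace (n : ℕ) : Set (ZMod (2 * n) → 𝕜) :=
  {x | ∃ v, IsTwistedPolygon n v 1 ∧ InGeneralPosition v ∧ HasCornerInvariants n v x}

theorem closedSpace_subset_twistedSpace (n : ℕ) : closedSpace 𝕜 n ⊆ twistedSpace 𝕜 n :=
  fun _ ⟨v, h⟩ => ⟨v, 1, h⟩

end Polygons

/-! ### The Poisson bracket, Hamiltonian vector fields, monodromy invariants -/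

section Poisson

variable {𝕜 : Type*} [Field 𝕜] {n : ℕ} [NeZero n]

/-- The coefficients `c i j` of the bracket `{xᵢ, xⱼ} = c i j xᵢ xⱼ` of coordinate functions:
`{xᵢ, xᵢ₊₂} = (-1)ⁱ xᵢ xᵢ₊₂`, antisymmetry, and all other brackets vanish. -/
def bracketCoeff (i j : ZMod (2 * n)) : ℤ :=
  if j = i + 2 then (-1) ^ i.val else if i = j + 2 then -(-1) ^ j.val else 0

/-- The Poisson bracket on polynomials in the corner coordinates: the extension of the brackets
of the coordinate functions by the Leibniz rule. -/
def poissonBracket (f g : MvPolynomial (ZMod (2 * n)) 𝕜) : MvPolynomial (ZMod (2 * n)) 𝕜 :=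
  ∑ i, ∑ j, MvPolynomial.C (bracketCoeff i j : 𝕜) * MvPolynomial.X i * MvPolynomial.X j *
    MvPolynomial.pderiv i f * MvPolynomial.pderiv j g

/-- The Hamiltonian vector field `X_f`, with `X_f (g) = {f, g}`, in the corner coordinates:
its component along `∂/∂xⱼ` is `{f, xⱼ}`. -/
def hamiltonianVectorField (f : MvPolynomial (ZMod (2 * n)) 𝕜) (x : ZMod (2 * n) → 𝕜) :
    ZMod (2 * n) → 𝕜 :=
  fun j => MvPolynomial.eval x (poissonBracket f (MvPolynomial.X j))

variable (𝕜) in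
/-- The elementary monomials. For `r = 0`: `Xᵢ = xᵢ₋₁ xᵢ xᵢ₊₁` for even `i` and `xᵢ` for odd `i`.
For `r = 1` the roles of even and odd are swapped. -/
def elementaryMonomial (r : ℕ) (i : ZMod (2 * n)) : MvPolynomial (ZMod (2 * n)) 𝕜 :=
  if i.val % 2 = r then
    MvPolynomial.X (i - 1) * MvPolynomial.X i * MvPolynomial.X (i + 1)
  else MvPolynomial.X i

variable (𝕜) in
/-- A set of (indices of) elementary monomials is admissible if these Poisson commute. -/
def IsAdmissible (r : ℕ) (S : Finset (ZMod (2 * n))) : Prop :=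
  ∀ i ∈ S, ∀ j ∈ S,
    poissonBracket (elementaryMonomial 𝕜 r i) (elementaryMonomial 𝕜 r j) = 0

open Classical in
variable (𝕜 n) in
/-- The alternating sum of all admissible monomials of weight `k`; the sign of a monomial is
`(-1)ᵗ` where `t` is the number of its factors `xⱼ`. This is `Oₖ` for `r = 0` and `Eₖ` for
`r = 1`. -/
def admissibleSum (r k : ℕ) : MvPolynomial (ZMod (2 * n)) 𝕜 :=
  ∑ S ∈ (Finset.univ.powersetCard k).filter (IsAdmissible 𝕜 r),
    (-1) ^ (S.filter fun i => i.val % 2 ≠ r).card * ∏ i ∈ S, elementaryMonomial 𝕜 r i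

variable (𝕜 n) in
/-- `Oₙ = x₁ x₃ ⋯ x₂ₙ₋₁`. -/
def oddProduct : MvPolynomial (ZMod (2 * n)) 𝕜 :=
  ∏ i : ZMod (2 * n) with i.val % 2 = 1, MvPolynomial.X i

variable (𝕜 n) in
/-- `Eₙ = x₂ x₄ ⋯ x₂ₙ`. -/
def evenProduct : MvPolynomial (ZMod (2 * n)) 𝕜 :=
  ∏ i : ZMod (2 * n) with i.val % 2 = 0, MvPolynomial.X i

/-- The monodromy invariants `O₁, …, O_[n/2], Oₙ, E₁, …, E_[n/2], Eₙ`. -/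
inductive IsMonodromyInvariant : MvPolynomial (ZMod (2 * n)) 𝕜 → Prop
  | O (k : ℕ) (hk : 1 ≤ k) (hk' : k ≤ n / 2) : IsMonodromyInvariant (admissibleSum 𝕜 n 0 k)
  | E (k : ℕ) (hk : 1 ≤ k) (hk' : k ≤ n / 2) : IsMonodromyInvariant (admissibleSum 𝕜 n 1 k)
  | On : IsMonodromyInvariant (oddProduct 𝕜 n)
  | En : IsMonodromyInvariant (evenProduct 𝕜 n)

end Poisson

/-- The vector `w` is tangent to the subset `S` at the point `x`: it is the velocity at `x` of an
analytic arc contained in `S`. -/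
def IsTangentAt {𝕜 : Type*} [RCLike 𝕜] {ι : Type*} [Fintype ι] (S : Set (ι → 𝕜)) (x w : ι → 𝕜) :
    Prop :=
  ∃ γ : 𝕜 → ι → 𝕜,
    AnalyticAt 𝕜 γ 0 ∧ γ 0 = x ∧ (∀ᶠ t in 𝓝 (0 : 𝕜), γ t ∈ S) ∧ HasDerivAt γ w 0

end Pentagram

end

set_option linter.unusedSectionVars false

open scoped LinearAlgebra.Projectivization MatrixGroups Topology

noncomputable section

/-! A closed polygon lifts to an `n`-periodic sequence of vectors with `V m = a V (m-1) + b V (m-2)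
+ c V (m-3)`, all coefficients depending on `m`. Rescaling `V` by products of the `a`'s turns this
into `e m = e (m-1) + p m * e (m-2) + q m * e (m-3)`, where `p m = -x (dimer n m)` and `q m = x
(dimer n (m-1)) * x (trimer n m) * x (dimer n m)` are the signed elementary monomials of the `E k`.
To move the corner coordinates with a given velocity inside the closed polygons it suffices to find
a periodic `W` solving the correspondingly linearized recursion: then `V + t W` is an arc of closed
polygons (`isTangentAt_of_mem_deformationSpace`).

The recursion is tied to the invariants by tilings. Two distinct elementary monomials commute
exactly when the tiles they occupy on a ring of `n` cells are disjoint
(`elementaryBracketCoeff_eq_zero_iff`), so `∑ l ^ k E k` is the partition function of dimers and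
trimers with weights `l p` and `l q`. The bracket is log-canonical, so its Hamiltonian field is a
combination of the partial sums through single tiles. The partition functions of chains of cells
obey the same kind of three-term recursion as `e`, and `deformation_identity` shows that an explicit
combination `A V m + B V (m-1) + G V (m-2)`, with `A, B, G` built from them and the `a`'s, solves
the linearized recursion up to the factor `-(l - 1)`. Everything in it is periodic, so for `l ≠ 1`
the generating field is tangent; comparing powers of `l` gives each `E k`.

Reversing the polygon exchanges `E k` and `O k` and preserves the bracket. The products of all even
or of all odd coordinates are Casimirs. -/

namespace Pentagram

/-! ### Partition functions of disjoint tiles -/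

section Tiles

variable {α β R : Type*} [Fintype α] [DecidableEq α] [DecidableEq β] [CommRing R]

/-- The families of pairwise disjoint tiles contained in the region `C`; the tile `i` covers the
cells `cells i`. -/
def packings (cells : α → Finset β) (C : Finset β) : Finset (Finset α) :=
  {S | (∀ i ∈ S, cells i ⊆ C) ∧ ∀ i ∈ S, ∀ j ∈ S, i ≠ j → Disjoint (cells i) (cells j)}

theorem mem_packings {cells : α → Finset β} {C : Finset β} {S : Finset α} :
    S ∈ packings cells C ↔
      (∀ i ∈ S, cells i ⊆ C) ∧ ∀ i ∈ S, ∀ j ∈ S, i ≠ j → Disjoint (cells i) (cells j) := by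
  simp [packings]

/-- The partition function of the packings of the region `C`. -/
def packingSum (cells : α → Finset β) (w : α → R) (C : Finset β) : R :=
  ∑ S ∈ packings cells C, ∏ i ∈ S, w i

/-- The part of the partition function which comes from the packings that contain the tile `i`. -/
def packingSumThrough (cells : α → Finset β) (w : α → R) (C : Finset β) (i : α) : R :=
  ∑ S ∈ packings cells C with i ∈ S, ∏ i ∈ S, w i

/-- Removing the tile `i` is inverse to inserting it. Nonemptiness matters: a tile without cells
could already belong to a packing of the complement. -/
theorem packingSumThrough_eq (cells : α → Finset β) (w : α → R) {C : Finset β} {i : α}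
    (hi : cells i ⊆ C) (hne : (cells i).Nonempty) :
    packingSumThrough cells w C i = w i * packingSum cells w (C \ cells i) := by
  unfold packingSumThrough packingSum
  rw [Finset.mul_sum]
  symm
  have hnot : ∀ S ∈ packings cells (C \ cells i), i ∉ S := by
    intro S hS hiS
    obtain ⟨c, hc⟩ := hne
    have := (mem_packings.1 hS).1 i hiS hc
    simp [hc] at this
  refine Finset.sum_bij' (fun S _ => insert i S) (fun S _ => S.erase i) ?_ ?_ ?_ ?_ ?_
  · intro S hS
    rw [Finset.mem_filter, mem_packings]
    obtain ⟨h1, h2⟩ := mem_packings.1 hS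
    refine ⟨⟨?_, ?_⟩, Finset.mem_insert_self _ _⟩
    · intro j hj
      rcases Finset.mem_insert.1 hj with rfl | hj
      · exact hi
      · exact (h1 j hj).trans Finset.sdiff_subset
    · intro j hj k hk hjk
      rcases Finset.mem_insert.1 hj with hj' | hj' <;>
        rcases Finset.mem_insert.1 hk with hk' | hk'
      · exact absurd (hj'.trans hk'.symm) hjk
      · exact hj' ▸ (Finset.disjoint_of_subset_left (h1 k hk') Finset.sdiff_disjoint).symm
      · exact hk' ▸ Finset.disjoint_of_subset_left (h1 j hj') Finset.sdiff_disjoint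
      · exact h2 j hj' k hk' hjk
  · intro S hS
    obtain ⟨hS, hiS⟩ := Finset.mem_filter.1 hS
    obtain ⟨h1, h2⟩ := mem_packings.1 hS
    rw [mem_packings]
    refine ⟨fun j hj => ?_, fun j hj k hk => h2 j (Finset.mem_of_mem_erase hj) k
      (Finset.mem_of_mem_erase hk)⟩
    obtain ⟨hji, hj⟩ := Finset.mem_erase.1 hj
    exact Finset.subset_sdiff.2 ⟨h1 j hj, h2 j hj i hiS hji⟩
  · intro S hS
    exact Finset.erase_insert (hnot S hS)
  · intro S hS
    exact Finset.insert_erase (Finset.mem_filter.1 hS).2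
  · intro S hS
    rw [Finset.prod_insert (hnot S hS)]

/-- Expansion of the partition function along the tile which covers a given cell. -/
theorem packingSum_eq_erase_add (cells : α → Finset β) (w : α → R) (C : Finset β) (c : β) :
    packingSum cells w C = packingSum cells w (C.erase c) +
      ∑ i with c ∈ cells i ∧ cells i ⊆ C, w i * packingSum cells w (C \ cells i) := by
  have key : ∀ i ∈ Finset.univ.filter (fun i => c ∈ cells i ∧ cells i ⊆ C),
      w i * packingSum cells w (C \ cells i) = packingSumThrough cells w C i := by
    intro i hi
    obtain ⟨h1, h2⟩ := (Finset.mem_filter.1 hi).2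
    exact (packingSumThrough_eq cells w h2 ⟨c, h1⟩).symm
  rw [Finset.sum_congr rfl key]
  unfold packingSumThrough
  -- Tiles of a packing are disjoint, so at most one covers `c`; the classes through the various
  -- tiles covering `c` are therefore disjoint, and the packings outside all of them are those of
  -- `C.erase c`.
  rw [← Finset.sum_biUnion]
  · unfold packingSum
    rw [← Finset.sum_union]
    · refine Finset.sum_congr ?_ fun _ _ => rfl
      ext S
      simp only [Finset.mem_union, Finset.mem_biUnion, Finset.mem_filter, Finset.mem_univ,
        true_and]
      constructor
      · intro hS
        obtain ⟨h1, h2⟩ := mem_packings.1 hS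
        by_cases h : ∃ i ∈ S, c ∈ cells i
        · obtain ⟨i, hi, hci⟩ := h
          exact Or.inr ⟨i, ⟨hci, h1 i hi⟩, hS, hi⟩
        · push Not at h
          exact Or.inl (mem_packings.2
            ⟨fun i hi => Finset.subset_erase.2 ⟨h1 i hi, h i hi⟩, h2⟩)
      · rintro (hS | ⟨i, -, hS, -⟩)
        · obtain ⟨h1, h2⟩ := mem_packings.1 hS
          exact mem_packings.2 ⟨fun i hi => (h1 i hi).trans (Finset.erase_subset _ _), h2⟩
        · exact hS
    · rw [Finset.disjoint_left]
      intro S hS hS'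
      simp only [Finset.mem_biUnion, Finset.mem_filter, Finset.mem_univ, true_and] at hS'
      obtain ⟨i, ⟨hci, -⟩, -, hi⟩ := hS'
      exact (Finset.subset_erase.1 ((mem_packings.1 hS).1 i hi)).2 hci
  · intro i hi j hj hij
    simp only [Finset.coe_filter, Finset.mem_univ, true_and, Set.mem_ofPred_eq] at hi hj
    simp only [Function.onFun]
    rw [Finset.disjoint_left]
    intro S hS hS'
    have hd := (mem_packings.1 (Finset.mem_filter.1 hS).1).2 i (Finset.mem_filter.1 hS).2 j
      (Finset.mem_filter.1 hS').2 hij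
    exact Finset.disjoint_left.1 hd hi.1 hj.1

end Tiles

/-! ### The bracket in terms of the Euler operators -/

section Bracket

variable {𝕜 : Type*} [Field 𝕜] {n : ℕ} [NeZero n]

/-- The modulus is even, so parity survives reduction. -/
theorem val_add_mod_two (i j : ZMod (2 * n)) : (i + j).val % 2 = (i.val + j.val) % 2 := by
  rw [ZMod.val_add, Nat.mod_mul_right_mod]

theorem val_one_mod_two : (1 : ZMod (2 * n)).val % 2 = 1 := by
  rw [ZMod.val_one_eq_one_mod, Nat.mod_mul_right_mod]

theorem val_add_one_mod_two (i : ZMod (2 * n)) : (i + 1).val % 2 = (i.val + 1) % 2 := by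
  have h1 := val_one_mod_two (n := n)
  rw [val_add_mod_two]; omega

theorem val_sub_one_mod_two (i : ZMod (2 * n)) : (i - 1).val % 2 = (i.val + 1) % 2 := by
  have := val_add_one_mod_two (i - 1)
  rw [sub_add_cancel] at this
  omega

theorem val_intCast_mod_two (k : ℤ) : (((k : ZMod (2 * n)).val : ℕ) : ℤ) % 2 = k % 2 := by
  rw [ZMod.val_intCast]
  push_cast
  exact Int.emod_emod_of_dvd _ ⟨n, rfl⟩

theorem ofNat_ne_zero_of_lt {k : ℕ} (h0 : k ≠ 0) (hk : k < 2 * n) : (k : ZMod (2 * n)) ≠ 0 := by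
  intro h
  rw [ZMod.natCast_eq_zero_iff] at h
  exact absurd (Nat.le_of_dvd (Nat.pos_of_ne_zero h0) h) (by omega)

/-- The sign `(-1)ʲ`. -/
def paritySign (j : ZMod (2 * n)) : ℤ := (-1) ^ j.val

theorem paritySign_add_two (j : ZMod (2 * n)) : paritySign (j + 2) = paritySign j := by
  have h : (j + 2).val % 2 = j.val % 2 := by
    have h1 := val_add_one_mod_two (j + 1)
    have h2 := val_add_one_mod_two j
    rw [show j + 1 + 1 = j + 2 by ring] at h1
    omega
  unfold paritySign
  rw [neg_one_pow_eq_pow_mod_two, h, ← neg_one_pow_eq_pow_mod_two]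

theorem paritySign_of_odd {j : ZMod (2 * n)} (h : j.val % 2 = 1) : paritySign j = -1 :=
  Odd.neg_one_pow (Nat.odd_iff.2 h)

theorem paritySign_of_even {j : ZMod (2 * n)} (h : j.val % 2 = 0) : paritySign j = 1 :=
  Even.neg_one_pow (Nat.even_iff.2 h)

/-- Since `4 ≠ 0`, the two nonzero branches of the definition exclude each other; shifts by two
preserve parity, so both signs can be read off at `j`. -/
theorem bracketCoeff_eq (h4 : (4 : ZMod (2 * n)) ≠ 0) (i j : ZMod (2 * n)) :
    bracketCoeff i j =
      paritySign j * ((if i = j - 2 then 1 else 0) - (if i = j + 2 then 1 else 0)) := by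
  unfold bracketCoeff
  by_cases h1 : j = i + 2
  · have h2 : i ≠ j + 2 := fun h => h4 (by linear_combination -h1 - h)
    have h3 : i = j - 2 := by rw [h1]; ring
    rw [if_pos h1, if_pos h3, if_neg h2, h1, paritySign_add_two]
    simp [paritySign]
  · have h3 : i ≠ j - 2 := fun h => h1 (by rw [h]; ring)
    rw [if_neg h1, if_neg h3]
    split_ifs <;> simp [paritySign]

/-- The Euler operator `xₐ ∂/∂xₐ`. -/
def euler (a : ZMod (2 * n)) (f : MvPolynomial (ZMod (2 * n)) 𝕜) :
    MvPolynomial (ZMod (2 * n)) 𝕜 :=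
  MvPolynomial.X a * MvPolynomial.pderiv a f

theorem euler_mul (a : ZMod (2 * n)) (f g : MvPolynomial (ZMod (2 * n)) 𝕜) :
    euler a (f * g) = euler a f * g + f * euler a g := by
  unfold euler
  rw [MvPolynomial.pderiv_mul]
  ring

theorem euler_sum {ι : Type*} (a : ZMod (2 * n)) (s : Finset ι)
    (f : ι → MvPolynomial (ZMod (2 * n)) 𝕜) :
    euler a (∑ i ∈ s, f i) = ∑ i ∈ s, euler a (f i) := by
  simp [euler, Finset.mul_sum]

theorem euler_X (a b : ZMod (2 * n)) :
    euler a (MvPolynomial.X b : MvPolynomial (ZMod (2 * n)) 𝕜) =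
      ((if b = a then 1 else 0 : ℤ) : MvPolynomial (ZMod (2 * n)) 𝕜) * MvPolynomial.X b := by
  unfold euler
  split_ifs with h
  · subst h; simp
  · rw [MvPolynomial.pderiv_X_of_ne h]; simp

theorem euler_neg_one_pow (a : ZMod (2 * n)) (k : ℕ) :
    euler a ((-1) ^ k : MvPolynomial (ZMod (2 * n)) 𝕜) = 0 := by
  rcases neg_one_pow_eq_or (MvPolynomial (ZMod (2 * n)) 𝕜) k with h | h <;> rw [h] <;>
    simp [euler]

/-- Monomials are joint eigenvectors of the Euler operators, with their exponents as eigenvalues;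
brackets of monomials thus reduce to integer arithmetic. -/
theorem euler_mul_of_eigen {a : ZMod (2 * n)} {f g : MvPolynomial (ZMod (2 * n)) 𝕜} {c d : ℤ}
    (hf : euler a f = c * f) (hg : euler a g = d * g) :
    euler a (f * g) = ((c + d : ℤ) : MvPolynomial (ZMod (2 * n)) 𝕜) * (f * g) := by
  rw [euler_mul, hf, hg]
  push_cast
  ring

theorem euler_prod_of_eigen {ι : Type*} {a : ZMod (2 * n)} (s : Finset ι)
    (f : ι → MvPolynomial (ZMod (2 * n)) 𝕜) (c : ι → ℤ) (h : ∀ i ∈ s, euler a (f i) = c i * f i) :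
    euler a (∏ i ∈ s, f i) =
      ((∑ i ∈ s, c i : ℤ) : MvPolynomial (ZMod (2 * n)) 𝕜) * ∏ i ∈ s, f i := by
  classical
  induction s using Finset.induction_on with
  | empty => simp [euler]
  | insert i s hi ih =>
    rw [Finset.prod_insert hi, Finset.sum_insert hi]
    exact euler_mul_of_eigen (h i (Finset.mem_insert_self _ _))
      (ih fun j hj => h j (Finset.mem_insert_of_mem hj))

/-- Absorbing the factors `X i` and `X j` into the derivatives leaves constant coefficients, with
two neighbours `j - 2`, `j + 2` for each `j`. -/
theorem poissonBracket_eq (h4 : (4 : ZMod (2 * n)) ≠ 0)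
    (f g : MvPolynomial (ZMod (2 * n)) 𝕜) :
    poissonBracket f g =
      ∑ j, (paritySign j : MvPolynomial (ZMod (2 * n)) 𝕜) * euler j g *
        (euler (j - 2) f - euler (j + 2) f) := by
  unfold poissonBracket
  rw [Finset.sum_comm]
  refine Finset.sum_congr rfl fun j _ => ?_
  have : ∀ i : ZMod (2 * n),
      MvPolynomial.C (bracketCoeff i j : 𝕜) * MvPolynomial.X i * MvPolynomial.X j *
        MvPolynomial.pderiv i f * MvPolynomial.pderiv j g =
      (if i = j - 2 then (paritySign j : MvPolynomial (ZMod (2 * n)) 𝕜) * euler j g * euler i f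
        else 0) -
      (if i = j + 2 then (paritySign j : MvPolynomial (ZMod (2 * n)) 𝕜) * euler j g * euler i f
        else 0) := by
    intro i
    rw [bracketCoeff_eq h4]
    unfold euler
    split_ifs <;> simp <;> ring
  rw [Finset.sum_congr rfl fun i _ => this i, Finset.sum_sub_distrib]
  simp
  ring

theorem hamiltonianVectorField_eq (h4 : (4 : ZMod (2 * n)) ≠ 0)
    (f : MvPolynomial (ZMod (2 * n)) 𝕜) (x : ZMod (2 * n) → 𝕜) (j : ZMod (2 * n)) :
    hamiltonianVectorField f x j = paritySign j * x j *
      (MvPolynomial.eval x (euler (j - 2) f) - MvPolynomial.eval x (euler (j + 2) f)) := by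
  unfold hamiltonianVectorField
  rw [poissonBracket_eq h4, Finset.sum_eq_single j]
  · rw [euler_X]
    simp
  · intro b _ hb
    rw [euler_X, if_neg hb.symm]
    simp
  · simp

/-- The product of all variables of a given parity is a Casimir function. -/
theorem hamiltonianVectorField_parityProduct (h4 : (4 : ZMod (2 * n)) ≠ 0) (r : ℕ)
    (x : ZMod (2 * n) → 𝕜) :
    hamiltonianVectorField
      (∏ i : ZMod (2 * n) with i.val % 2 = r, MvPolynomial.X i :
        MvPolynomial (ZMod (2 * n)) 𝕜) x = 0 := by
  funext j
  have he : ∀ a : ZMod (2 * n), euler a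
      (∏ i : ZMod (2 * n) with i.val % 2 = r, MvPolynomial.X i :
        MvPolynomial (ZMod (2 * n)) 𝕜) =
      ((if a.val % 2 = r then 1 else 0 : ℤ) : MvPolynomial (ZMod (2 * n)) 𝕜) *
        ∏ i : ZMod (2 * n) with i.val % 2 = r, MvPolynomial.X i := by
    intro a
    rw [euler_prod_of_eigen _ _ _ fun i _ => euler_X a i]
    congr 2
    simp [Finset.sum_ite_eq', Finset.mem_filter]
  -- Both neighbours of `j` have the same parity, so the two Euler terms agree and cancel.
  have hp : (j - 2).val % 2 = (j + 2).val % 2 := by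
    have h1 := val_add_one_mod_two (j + 1)
    have h2 := val_add_one_mod_two j
    have h3 := val_sub_one_mod_two (j - 1)
    have h4 := val_sub_one_mod_two j
    rw [show j + 1 + 1 = j + 2 by ring] at h1
    rw [show j - 1 - 1 = j - 2 by ring] at h3
    omega
  rw [hamiltonianVectorField_eq h4, he, he, hp]
  simp

end Bracket

/-! ### Admissible families as packings of a ring of cells -/

section Ring

variable {𝕜 : Type*} [Field 𝕜] {n : ℕ} [NeZero n]

/-- The cells covered by the elementary monomial with index `i` (for `r = 1`); a cell is an odd
residue modulo `2n`. -/
def ringCells (i : ZMod (2 * n)) : Finset (ZMod (2 * n)) :=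
  if i.val % 2 = 1 then {i - 2, i, i + 2} else {i - 1, i + 1}

/-- The exponent of `xₐ` in the elementary monomial with index `i` (for `r = 1`). -/
def elementaryExponent (i a : ZMod (2 * n)) : ℤ :=
  (if i = a then 1 else 0) +
    if i.val % 2 = 1 then (if i - 1 = a then 1 else 0) + (if i + 1 = a then 1 else 0) else 0

theorem euler_elementaryMonomial (a i : ZMod (2 * n)) :
    euler a (elementaryMonomial 𝕜 1 i) =
      (elementaryExponent i a : MvPolynomial (ZMod (2 * n)) 𝕜) * elementaryMonomial 𝕜 1 i := by
  unfold elementaryMonomial elementaryExponent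
  split_ifs with h
  all_goals first
    | rw [euler_mul_of_eigen (euler_mul_of_eigen (euler_X a (i - 1)) (euler_X a i))
        (euler_X a (i + 1))]; simp_all; try ring
    | rw [euler_X]; simp_all

theorem elementaryMonomial_ne_zero (r : ℕ) (i : ZMod (2 * n)) :
    elementaryMonomial 𝕜 r i ≠ 0 := by
  unfold elementaryMonomial
  split_ifs
  · exact mul_ne_zero (mul_ne_zero (MvPolynomial.X_ne_zero _) (MvPolynomial.X_ne_zero _))
      (MvPolynomial.X_ne_zero _)
  · exact MvPolynomial.X_ne_zero _

theorem sum_elementaryExponent_mul (t : ZMod (2 * n)) (g : ZMod (2 * n) → ℤ) :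
    ∑ j, elementaryExponent t j * g j =
      g t + if t.val % 2 = 1 then g (t - 1) + g (t + 1) else 0 := by
  unfold elementaryExponent
  split_ifs <;> simp [add_mul, Finset.sum_add_distrib]

/-- The coefficient of the log-canonical bracket of two elementary monomials. -/
def elementaryBracketCoeff (s t : ZMod (2 * n)) : ℤ :=
  ∑ j, elementaryExponent t j *
    (paritySign j * (elementaryExponent s (j - 2) - elementaryExponent s (j + 2)))

theorem poissonBracket_elementaryMonomial (h4 : (4 : ZMod (2 * n)) ≠ 0) (s t : ZMod (2 * n)) :
    poissonBracket (elementaryMonomial 𝕜 1 s) (elementaryMonomial 𝕜 1 t) =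
      (elementaryBracketCoeff s t : MvPolynomial (ZMod (2 * n)) 𝕜) *
        (elementaryMonomial 𝕜 1 s * elementaryMonomial 𝕜 1 t) := by
  rw [poissonBracket_eq h4, elementaryBracketCoeff]
  push_cast
  rw [Finset.sum_mul]
  refine Finset.sum_congr rfl fun j _ => ?_
  rw [euler_elementaryMonomial, euler_elementaryMonomial, euler_elementaryMonomial]
  ring

/-- The indicator function of `0`. -/
def zeroIndicator (a : ZMod (2 * n)) : ℤ := if a = 0 then 1 else 0

theorem ite_eq_zeroIndicator (a b : ZMod (2 * n)) :
    (if a = b then 1 else 0 : ℤ) = zeroIndicator (b - a) := by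
  unfold zeroIndicator
  simp only [sub_eq_zero, eq_comm]

theorem zeroIndicator_of_ne {a b : ZMod (2 * n)} (h : a.val % 2 ≠ b.val % 2) :
    zeroIndicator (b - a) = 0 := by
  unfold zeroIndicator
  rw [if_neg]
  intro h'
  exact h (by rw [sub_eq_zero.1 h'])

theorem val_add_two_mod_two (u : ZMod (2 * n)) : (u + 2).val % 2 = u.val % 2 := by
  have h1 := val_add_one_mod_two (u + 1)
  have h2 := val_add_one_mod_two u
  rw [show u + 1 + 1 = u + 2 by ring] at h1
  omega

theorem val_sub_two_mod_two (u : ZMod (2 * n)) : (u - 2).val % 2 = u.val % 2 := by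
  have := val_add_two_mod_two (u - 2)
  rw [sub_add_cancel] at this
  exact this.symm

theorem elementaryBracketCoeff_even_even {s t : ZMod (2 * n)} (hs : s.val % 2 = 0)
    (ht : t.val % 2 = 0) :
    elementaryBracketCoeff s t = zeroIndicator (t - s - 2) - zeroIndicator (t - s + 2) := by
  unfold elementaryBracketCoeff
  rw [sum_elementaryExponent_mul]
  simp only [elementaryExponent, hs, ht, paritySign_of_even ht, ite_eq_zeroIndicator]
  simp only [zero_ne_one, if_false]
  ring_nf

theorem elementaryBracketCoeff_even_odd {s t : ZMod (2 * n)} (hs : s.val % 2 = 0)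
    (ht : t.val % 2 = 1) :
    elementaryBracketCoeff s t = zeroIndicator (t - s - 1) + zeroIndicator (t - s - 3) -
      zeroIndicator (t - s + 1) - zeroIndicator (t - s + 3) := by
  have h1 : (t - 1).val % 2 = 0 := by rw [val_sub_one_mod_two]; omega
  have h2 : (t + 1).val % 2 = 0 := by rw [val_add_one_mod_two]; omega
  have a1 : zeroIndicator (t - 2 - s) = 0 :=
    zeroIndicator_of_ne (by rw [val_sub_two_mod_two]; omega)
  have a2 : zeroIndicator (t + 2 - s) = 0 :=
    zeroIndicator_of_ne (by rw [val_add_two_mod_two]; omega)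
  unfold elementaryBracketCoeff
  rw [sum_elementaryExponent_mul]
  simp only [elementaryExponent, hs, ht, paritySign_of_odd ht, paritySign_of_even h1,
    paritySign_of_even h2, ite_eq_zeroIndicator, a1, a2]
  simp only [zero_ne_one, if_false, if_true]
  ring_nf

theorem elementaryBracketCoeff_odd_even {s t : ZMod (2 * n)} (hs : s.val % 2 = 1)
    (ht : t.val % 2 = 0) :
    elementaryBracketCoeff s t = zeroIndicator (t - s - 1) + zeroIndicator (t - s - 3) -
      zeroIndicator (t - s + 1) - zeroIndicator (t - s + 3) := by
  have a1 : zeroIndicator (t - 2 - s) = 0 :=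
    zeroIndicator_of_ne (by rw [val_sub_two_mod_two]; omega)
  have a2 : zeroIndicator (t + 2 - s) = 0 :=
    zeroIndicator_of_ne (by rw [val_add_two_mod_two]; omega)
  unfold elementaryBracketCoeff
  rw [sum_elementaryExponent_mul]
  simp only [elementaryExponent, hs, ht, paritySign_of_even ht, ite_eq_zeroIndicator, a1, a2]
  simp only [zero_ne_one, if_false, if_true]
  ring_nf

theorem elementaryBracketCoeff_odd_odd {s t : ZMod (2 * n)} (hs : s.val % 2 = 1)
    (ht : t.val % 2 = 1) :
    elementaryBracketCoeff s t = zeroIndicator (t - s - 2) + zeroIndicator (t - s - 4) -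
      zeroIndicator (t - s + 2) - zeroIndicator (t - s + 4) := by
  have h1 : (t - 1).val % 2 = 0 := by rw [val_sub_one_mod_two]; omega
  have h2 : (t + 1).val % 2 = 0 := by rw [val_add_one_mod_two]; omega
  have h3 : (s - 1).val % 2 = 0 := by rw [val_sub_one_mod_two]; omega
  have h4 : (s + 1).val % 2 = 0 := by rw [val_add_one_mod_two]; omega
  have b1 := val_add_two_mod_two t
  have b2 := val_sub_two_mod_two t
  have c1 : zeroIndicator (t - 2 - (s - 1)) = 0 := zeroIndicator_of_ne (by omega)
  have c2 : zeroIndicator (t + 2 - (s - 1)) = 0 := zeroIndicator_of_ne (by omega)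
  have c7 : zeroIndicator (t - 2 - (s + 1)) = 0 := zeroIndicator_of_ne (by omega)
  have c8 : zeroIndicator (t + 2 - (s + 1)) = 0 := zeroIndicator_of_ne (by omega)
  have c3 : zeroIndicator (t + 1 + 2 - s) = 0 :=
    zeroIndicator_of_ne (by rw [val_add_two_mod_two]; omega)
  have c4 : zeroIndicator (t - 1 - 2 - s) = 0 :=
    zeroIndicator_of_ne (by rw [val_sub_two_mod_two]; omega)
  have c5 : zeroIndicator (t + 1 - 2 - s) = 0 :=
    zeroIndicator_of_ne (by rw [val_sub_two_mod_two]; omega)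
  have c6 : zeroIndicator (t - 1 + 2 - s) = 0 :=
    zeroIndicator_of_ne (by rw [val_add_two_mod_two]; omega)
  unfold elementaryBracketCoeff
  rw [sum_elementaryExponent_mul]
  simp only [elementaryExponent, hs, ht, paritySign_of_odd ht, paritySign_of_even h1,
    paritySign_of_even h2, ite_eq_zeroIndicator, c1, c2, c3, c4, c5, c6,
    c7, c8]
  simp only [if_true]
  ring_nf

/-- For each pair of parities the coefficient is a signed sum of indicators of precisely those
differences `t - s` at which distinct tiles overlap. Opposite signs never meet, because 2, 4, 6 and
8 are nonzero modulo `2n`; for `n = 4` the differences 4 and -4 would cancel. -/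
theorem elementaryBracketCoeff_eq_zero_iff (hn : 5 ≤ n) {s t : ZMod (2 * n)} (hst : s ≠ t) :
    elementaryBracketCoeff s t = 0 ↔ Disjoint (ringCells s) (ringCells t) := by
  have ne (k : ℕ) (h0 : k ≠ 0) (hk : k < 10) : (k : ZMod (2 * n)) ≠ 0 :=
    ofNat_ne_zero_of_lt h0 (by omega)
  have e2 : (2 : ZMod (2 * n)) ≠ 0 := by exact_mod_cast ne 2 (by simp) (by simp)
  have e4 : (4 : ZMod (2 * n)) ≠ 0 := by exact_mod_cast ne 4 (by simp) (by simp)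
  have e6 : (6 : ZMod (2 * n)) ≠ 0 := by exact_mod_cast ne 6 (by simp) (by simp)
  have e8 : (8 : ZMod (2 * n)) ≠ 0 := by exact_mod_cast ne 8 (by simp) (by simp)
  rcases Nat.mod_two_eq_zero_or_one s.val with hs | hs <;>
    rcases Nat.mod_two_eq_zero_or_one t.val with ht | ht
  · rw [elementaryBracketCoeff_even_even hs ht]
    simp only [ringCells, hs, ht, zeroIndicator]
    simp
    grind
  · rw [elementaryBracketCoeff_even_odd hs ht]
    simp only [ringCells, hs, ht, zeroIndicator]
    simp
    grind
  · rw [elementaryBracketCoeff_odd_even hs ht]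
    simp only [ringCells, hs, ht, zeroIndicator]
    simp
    grind
  · rw [elementaryBracketCoeff_odd_odd hs ht]
    simp only [ringCells, hs, ht, zeroIndicator]
    simp
    grind

end Ring

/-! ### The Hamiltonian vector fields in terms of packings -/

section Field

variable {𝕜 : Type*} [Field 𝕜] {n : ℕ} [NeZero n]

/-- A bracket of elementary monomials is an integer times their nonzero product, and in
characteristic zero it vanishes only with that integer. The diagonal pairs, where tiles are never
disjoint, commute trivially. -/
theorem isAdmissible_iff_mem_packings [CharZero 𝕜] (hn : 5 ≤ n) (S : Finset (ZMod (2 * n))) :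
    IsAdmissible 𝕜 1 S ↔ S ∈ packings ringCells Finset.univ := by
  have h4 : (4 : ZMod (2 * n)) ≠ 0 := by
    exact_mod_cast ofNat_ne_zero_of_lt (n := n) (k := 4) (by omega) (by omega)
  rw [mem_packings]
  unfold IsAdmissible
  have key : ∀ i j : ZMod (2 * n), poissonBracket (elementaryMonomial 𝕜 1 i)
      (elementaryMonomial 𝕜 1 j) = 0 ↔ elementaryBracketCoeff i j = 0 := by
    intro i j
    rw [poissonBracket_elementaryMonomial h4, mul_eq_zero, Int.cast_eq_zero]
    exact or_iff_left (mul_ne_zero (elementaryMonomial_ne_zero _ _)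
      (elementaryMonomial_ne_zero _ _))
  have hself : ∀ i : ZMod (2 * n), elementaryBracketCoeff i i = 0 := by
    intro i
    rcases Nat.mod_two_eq_zero_or_one i.val with h | h
    · rw [elementaryBracketCoeff_even_even h h]; simp [zeroIndicator]
    · rw [elementaryBracketCoeff_odd_odd h h]; simp [zeroIndicator]
  simp only [key, Finset.subset_univ, implies_true, true_and]
  refine forall₄_congr fun i _ j _ => ?_
  by_cases hij : i = j
  · subst hij; simp [hself]
  · rw [elementaryBracketCoeff_eq_zero_iff hn hij]; simp [hij]

/-- The signed value of the elementary monomial with index `i` (for `r = 1`) at `x`. -/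
def ringWeight (x : ZMod (2 * n) → 𝕜) (i : ZMod (2 * n)) : 𝕜 :=
  if i.val % 2 = 1 then x (i - 1) * x i * x (i + 1) else -x i

theorem eval_signed_prod_elementaryMonomial (x : ZMod (2 * n) → 𝕜) (S : Finset (ZMod (2 * n))) :
    MvPolynomial.eval x ((-1) ^ (S.filter fun i => i.val % 2 ≠ 1).card *
      ∏ i ∈ S, elementaryMonomial 𝕜 1 i) = ∏ i ∈ S, ringWeight x i := by
  rw [← Finset.prod_const, Finset.prod_filter, ← Finset.prod_mul_distrib, map_prod]
  refine Finset.prod_congr rfl fun i _ => ?_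
  unfold ringWeight elementaryMonomial
  split_ifs <;> simp_all

/-- The part of the partition function of the ring (with fugacity `l`) which comes from the
packings through the tile `i`. -/
def ringThrough (x : ZMod (2 * n) → 𝕜) (l : 𝕜) (i : ZMod (2 * n)) : 𝕜 :=
  packingSumThrough ringCells (fun i => l * ringWeight x i) Finset.univ i

theorem eval_euler_admissibleSum [CharZero 𝕜] (hn : 5 ≤ n) (x : ZMod (2 * n) → 𝕜)
    (a : ZMod (2 * n)) (k : ℕ) :
    MvPolynomial.eval x (euler a (admissibleSum 𝕜 n 1 k)) =
      ∑ S ∈ packings ringCells Finset.univ with S.card = k,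
        ((∑ i ∈ S, elementaryExponent i a : ℤ) : 𝕜) * ∏ i ∈ S, ringWeight x i := by
  unfold admissibleSum
  rw [euler_sum, map_sum]
  refine Finset.sum_congr ?_ fun S _ => ?_
  · ext S
    simp [isAdmissible_iff_mem_packings (𝕜 := 𝕜) hn, and_comm]
  · rw [euler_mul, euler_neg_one_pow, zero_mul, zero_add,
      euler_prod_of_eigen S _ (fun i => elementaryExponent i a)
        fun i _ => euler_elementaryMonomial a i,
      ← eval_signed_prod_elementaryMonomial]
    simp only [map_mul, map_intCast]
    ring

/-- Giving each tile the fugacity `l` collects all sizes `k` at once; exchanging the sums over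
packings and over their tiles leaves the sums through single tiles. The range is exhaustive, as
there are only `2n` tiles. -/
theorem sum_pow_mul_eval_euler_admissibleSum [CharZero 𝕜] (hn : 5 ≤ n) (x : ZMod (2 * n) → 𝕜)
    (l : 𝕜) (a : ZMod (2 * n)) :
    ∑ k ∈ Finset.range (2 * n + 1),
        l ^ k * MvPolynomial.eval x (euler a (admissibleSum 𝕜 n 1 k)) =
      ∑ i, (elementaryExponent i a : 𝕜) * ringThrough x l i := by
  have h1 : ∀ k ∈ Finset.range (2 * n + 1),
      l ^ k * MvPolynomial.eval x (euler a (admissibleSum 𝕜 n 1 k)) =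
      ∑ S ∈ packings ringCells Finset.univ with S.card = k,
        ∑ i ∈ S, (elementaryExponent i a : 𝕜) * ∏ i ∈ S, l * ringWeight x i := by
    intro k _
    rw [eval_euler_admissibleSum hn, Finset.mul_sum]
    refine Finset.sum_congr rfl fun S hS => ?_
    rw [← Finset.sum_mul, Finset.prod_mul_distrib, Finset.prod_const, (Finset.mem_filter.1 hS).2]
    push_cast
    ring
  rw [Finset.sum_congr rfl h1, Finset.sum_fiberwise_of_maps_to]
  · unfold ringThrough packingSumThrough
    simp only [Finset.mul_sum, Finset.sum_filter]
    rw [Finset.sum_comm]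
    refine Finset.sum_congr rfl fun S _ => ?_
    simp only [mul_ite, mul_zero, Finset.sum_ite_mem, Finset.univ_inter]
  · intro S _
    rw [Finset.mem_range]
    have := Finset.card_le_univ S
    rw [ZMod.card] at this
    omega

/-- An even variable occurs in its own dimer and in the two adjacent trimers, an odd one only in its
own trimer. -/
theorem sum_elementaryExponent_mul_of_even {a : ZMod (2 * n)} (ha : a.val % 2 = 0)
    (f : ZMod (2 * n) → 𝕜) :
    ∑ i, (elementaryExponent i a : 𝕜) * f i = f (a - 1) + f a + f (a + 1) := by
  have h1 := val_sub_one_mod_two a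
  have h2 := val_add_one_mod_two a
  have : ∀ i, (elementaryExponent i a : 𝕜) * f i =
      (if i = a - 1 then f i else 0) + (if i = a then f i else 0) +
        (if i = a + 1 then f i else 0) := by
    intro i
    have e1 : i - 1 = a ↔ i = a + 1 := sub_eq_iff_eq_add
    have e2 : i + 1 = a ↔ i = a - 1 := eq_sub_iff_add_eq.symm
    unfold elementaryExponent
    rw [if_congr e1 rfl rfl, if_congr e2 rfl rfl]
    by_cases hi : i.val % 2 = 1
    · rw [if_pos hi]
      push_cast
      split_ifs <;> ring
    · rw [if_neg hi, if_neg (c := i = a - 1), if_neg (c := i = a + 1)]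
      · push_cast
        split_ifs <;> ring
      · rintro rfl; omega
      · rintro rfl; omega
  rw [Finset.sum_congr rfl fun i _ => this i]
  simp [Finset.sum_add_distrib]

theorem sum_elementaryExponent_mul_of_odd {a : ZMod (2 * n)} (ha : a.val % 2 = 1)
    (f : ZMod (2 * n) → 𝕜) :
    ∑ i, (elementaryExponent i a : 𝕜) * f i = f a := by
  have : ∀ i, (elementaryExponent i a : 𝕜) * f i = if i = a then f i else 0 := by
    intro i
    unfold elementaryExponent
    by_cases hi : i.val % 2 = 1
    · have e1 : i - 1 ≠ a := by
        rintro rfl; have := val_sub_one_mod_two i; omega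
      have e2 : i + 1 ≠ a := by
        rintro rfl; have := val_add_one_mod_two i; omega
      rw [if_neg e1, if_neg e2]
      split_ifs <;> simp
    · rw [if_neg hi]
      split_ifs <;> simp
  rw [Finset.sum_congr rfl fun i _ => this i]
  simp

/-- The generating function of the Hamiltonian vector fields of `E₀, E₁, …`. -/
def ringField (x : ZMod (2 * n) → 𝕜) (l : 𝕜) : ZMod (2 * n) → 𝕜 :=
  ∑ k ∈ Finset.range (2 * n + 1), l ^ k • hamiltonianVectorField (admissibleSum 𝕜 n 1 k) x

theorem ringField_apply [CharZero 𝕜] (hn : 5 ≤ n) (x : ZMod (2 * n) → 𝕜) (l : 𝕜)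
    (j : ZMod (2 * n)) :
    ringField x l j = paritySign j * x j *
      (∑ i, (elementaryExponent i (j - 2) : 𝕜) * ringThrough x l i -
        ∑ i, (elementaryExponent i (j + 2) : 𝕜) * ringThrough x l i) := by
  have h4 : (4 : ZMod (2 * n)) ≠ 0 := by
    exact_mod_cast ofNat_ne_zero_of_lt (n := n) (k := 4) (by omega) (by omega)
  rw [← sum_pow_mul_eval_euler_admissibleSum hn, ← sum_pow_mul_eval_euler_admissibleSum hn,
    ringField, Finset.sum_apply, ← Finset.sum_sub_distrib, Finset.mul_sum]
  refine Finset.sum_congr rfl fun k _ => ?_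
  rw [Pi.smul_apply, hamiltonianVectorField_eq h4, smul_eq_mul]
  ring

theorem ringField_of_even [CharZero 𝕜] (hn : 5 ≤ n) (x : ZMod (2 * n) → 𝕜) (l : 𝕜)
    {j : ZMod (2 * n)} (hj : j.val % 2 = 0) :
    ringField x l j = x j *
      (ringThrough x l (j - 3) + ringThrough x l (j - 2) + ringThrough x l (j - 1) -
        ringThrough x l (j + 1) - ringThrough x l (j + 2) - ringThrough x l (j + 3)) := by
  rw [ringField_apply hn, paritySign_of_even hj,
    sum_elementaryExponent_mul_of_even (by rw [val_sub_two_mod_two, hj]),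
    sum_elementaryExponent_mul_of_even (by rw [val_add_two_mod_two, hj]),
    show j - 2 - 1 = j - 3 by ring, show j - 2 + 1 = j - 1 by ring,
    show j + 2 - 1 = j + 1 by ring, show j + 2 + 1 = j + 3 by ring]
  push_cast
  ring

theorem ringField_of_odd [CharZero 𝕜] (hn : 5 ≤ n) (x : ZMod (2 * n) → 𝕜) (l : 𝕜)
    {j : ZMod (2 * n)} (hj : j.val % 2 = 1) :
    ringField x l j = x j * (ringThrough x l (j + 2) - ringThrough x l (j - 2)) := by
  rw [ringField_apply hn, paritySign_of_odd hj,
    sum_elementaryExponent_mul_of_odd (by rw [val_sub_two_mod_two, hj]),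
    sum_elementaryExponent_mul_of_odd (by rw [val_add_two_mod_two, hj])]
  push_cast
  ring

end Field

theorem packings_congr {α β : Type*} [Fintype α] [DecidableEq α] [DecidableEq β]
    {cells : α → Finset β} {C D : Finset β} (h : ∀ i, cells i ⊆ C ↔ cells i ⊆ D) :
    packings cells C = packings cells D := by
  ext S
  simp only [mem_packings, h]

/-! ### Partition functions of intervals of the ring -/

section Intervals

variable {n : ℕ} [NeZero n]

/-- The `m`-th cell of the ring, for an integer `m`. -/
def cell (n : ℕ) (m : ℤ) : ZMod (2 * n) := ((2 * m - 3 : ℤ) : ZMod (2 * n))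

/-- The index of the tile which covers the cells `m - 1` and `m`. -/
def dimer (n : ℕ) (m : ℤ) : ZMod (2 * n) := ((2 * m - 4 : ℤ) : ZMod (2 * n))

/-- The index of the tile which covers the cells `m - 2`, `m - 1` and `m`. -/
def trimer (n : ℕ) (m : ℤ) : ZMod (2 * n) := ((2 * m - 5 : ℤ) : ZMod (2 * n))

/-- The cells `a + 1, …, b` of the ring. -/
def cellInterval (n : ℕ) (a b : ℤ) : Finset (ZMod (2 * n)) := (Finset.Ioc a b).image (cell n)

theorem cell_eq_cell_iff {k m : ℤ} : cell n k = cell n m ↔ (n : ℤ) ∣ m - k := by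
  unfold cell
  rw [ZMod.intCast_eq_intCast_iff_dvd_sub]
  push_cast
  rw [show 2 * m - 3 - (2 * k - 3) = 2 * (m - k) by ring]
  exact mul_dvd_mul_iff_left two_ne_zero

theorem cell_inj_of_lt {k m : ℤ} (h : cell n k = cell n m) (h1 : m - k < n) (h2 : k - m < n) :
    k = m := by
  have := Int.eq_zero_of_abs_lt_dvd (cell_eq_cell_iff.1 h) (abs_lt.2 ⟨by omega, h1⟩)
  omega

theorem cell_add_period (m : ℤ) : cell n (m + n) = cell n m :=
  cell_eq_cell_iff.2 ⟨-1, by ring⟩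

theorem dimer_add_period (m : ℤ) : dimer n (m + n) = dimer n m := by
  unfold dimer
  rw [ZMod.intCast_eq_intCast_iff_dvd_sub]
  exact ⟨-1, by push_cast; ring⟩

theorem trimer_add_period (m : ℤ) : trimer n (m + n) = trimer n m := by
  unfold trimer
  rw [ZMod.intCast_eq_intCast_iff_dvd_sub]
  exact ⟨-1, by push_cast; ring⟩

theorem val_cell_mod_two (m : ℤ) : (cell n m).val % 2 = 1 := by
  have := val_intCast_mod_two (n := n) (2 * m - 3)
  unfold cell
  omega

theorem val_dimer_mod_two (m : ℤ) : (dimer n m).val % 2 = 0 := by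
  have := val_intCast_mod_two (n := n) (2 * m - 4)
  unfold dimer
  omega

theorem val_trimer_mod_two (m : ℤ) : (trimer n m).val % 2 = 1 := by
  have := val_intCast_mod_two (n := n) (2 * m - 5)
  unfold trimer
  omega

theorem cellInterval_singleton (m : ℤ) : cellInterval n (m - 1) m = {cell n m} := by
  unfold cellInterval
  rw [show Finset.Ioc (m - 1) m = {m} by ext; simp; omega]
  simp

/-- The offsets in `cell`, `dimer` and `trimer` are such that tiles numbered `m` end at the cell
`m`; they will weight the terms `V (m - 2)` and `V (m - 3)` in the expansion of `V m`. -/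
theorem ringCells_dimer (m : ℤ) : ringCells (dimer n m) = cellInterval n (m - 2) m := by
  unfold ringCells cellInterval
  rw [val_dimer_mod_two, if_neg zero_ne_one,
    show Finset.Ioc (m - 2) m = {m - 1, m} by ext; simp; omega]
  simp only [Finset.image_insert, Finset.image_singleton, dimer, cell]
  push_cast
  congr 1
  · ring
  · congr 1; ring

theorem ringCells_trimer (m : ℤ) : ringCells (trimer n m) = cellInterval n (m - 3) m := by
  unfold ringCells cellInterval
  rw [val_trimer_mod_two, if_pos rfl,
    show Finset.Ioc (m - 3) m = {m - 2, m - 1, m} by ext; simp; omega]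
  simp only [Finset.image_insert, Finset.image_singleton, trimer, cell]
  push_cast
  congr 1
  · ring
  · congr 1
    · ring
    · congr 1; ring

theorem exists_eq_cell {c : ZMod (2 * n)} (hc : c.val % 2 = 1) (a : ℤ) :
    c ∈ cellInterval n a (a + n) := by
  have hn : (0 : ℤ) < n := by exact_mod_cast Nat.pos_of_ne_zero (NeZero.ne n)
  obtain ⟨k, hk⟩ : ∃ k : ℤ, c = cell n k := by
    refine ⟨(c.val + 3) / 2, ?_⟩
    have h : 2 * (((c.val : ℤ) + 3) / 2) - 3 = c.val := by omega
    unfold cell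
    rw [h]
    simp
  unfold cellInterval
  rw [Finset.mem_image]
  have h1 := Int.emod_nonneg (k - (a + 1)) hn.ne'
  have h2 := Int.emod_lt_of_pos (k - (a + 1)) hn
  refine ⟨a + 1 + (k - (a + 1)) % n, Finset.mem_Ioc.2 ⟨by omega, by omega⟩, ?_⟩
  rw [hk]
  refine cell_eq_cell_iff.2 ⟨(k - (a + 1)) / n, ?_⟩
  have := Int.mul_ediv_add_emod (k - (a + 1)) n
  omega

theorem eq_dimer_or_eq_trimer (i : ZMod (2 * n)) :
    (∃ m, i = dimer n m) ∨ ∃ m, i = trimer n m := by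
  rcases Nat.mod_two_eq_zero_or_one i.val with h | h
  · refine Or.inl ⟨(i.val + 4) / 2, ?_⟩
    have h : 2 * (((i.val : ℤ) + 4) / 2) - 4 = i.val := by omega
    unfold dimer
    rw [h]
    simp
  · refine Or.inr ⟨(i.val + 5) / 2, ?_⟩
    have h : 2 * (((i.val : ℤ) + 5) / 2) - 5 = i.val := by omega
    unfold trimer
    rw [h]
    simp

theorem ringCells_subset (i : ZMod (2 * n)) (a : ℤ) :
    ringCells i ⊆ cellInterval n a (a + n) := by
  intro c hc
  apply exists_eq_cell
  rcases eq_dimer_or_eq_trimer i with ⟨m, rfl⟩ | ⟨m, rfl⟩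
  · rw [ringCells_dimer] at hc
    obtain ⟨k, -, rfl⟩ := Finset.mem_image.1 hc
    exact val_cell_mod_two k
  · rw [ringCells_trimer] at hc
    obtain ⟨k, -, rfl⟩ := Finset.mem_image.1 hc
    exact val_cell_mod_two k

/-- No tile covers an even residue, so only the `n` odd cells count, and the ring of these may be
cut open anywhere. -/
theorem packings_univ (a : ℤ) :
    packings ringCells (Finset.univ : Finset (ZMod (2 * n))) =
      packings ringCells (cellInterval n a (a + n)) :=
  packings_congr fun i => iff_of_true (Finset.subset_univ _) (ringCells_subset i a)

/-- The length bound keeps the interval from overlapping itself around the ring, which would remove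
cells of the remainder too. -/
theorem cellInterval_sdiff_left {a b c : ℤ} (hab : a ≤ b) (h : c - a ≤ n) :
    cellInterval n a c \ cellInterval n a b = cellInterval n b c := by
  ext x
  simp only [cellInterval, Finset.mem_sdiff, Finset.mem_image, Finset.mem_Ioc, not_exists, not_and]
  constructor
  · rintro ⟨⟨k, hk, rfl⟩, h2⟩
    exact ⟨k, ⟨by by_contra hkb; exact h2 k ⟨hk.1, by omega⟩ rfl, hk.2⟩, rfl⟩
  · rintro ⟨k, hk, rfl⟩
    refine ⟨⟨k, ⟨by omega, hk.2⟩, rfl⟩, fun m hm hmk => ?_⟩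
    have := cell_inj_of_lt hmk (by omega) (by omega)
    omega

theorem cellInterval_sdiff_right {a b c : ℤ} (hbc : b ≤ c) (h : c - a ≤ n) :
    cellInterval n a c \ cellInterval n b c = cellInterval n a b := by
  ext x
  simp only [cellInterval, Finset.mem_sdiff, Finset.mem_image, Finset.mem_Ioc, not_exists, not_and]
  constructor
  · rintro ⟨⟨k, hk, rfl⟩, h2⟩
    exact ⟨k, ⟨hk.1, by by_contra hkb; exact h2 k ⟨by omega, hk.2⟩ rfl⟩, rfl⟩
  · rintro ⟨k, hk, rfl⟩
    refine ⟨⟨k, ⟨hk.1, by omega⟩, rfl⟩, fun m hm hmk => ?_⟩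
    have := cell_inj_of_lt hmk (by omega) (by omega)
    omega

theorem cellInterval_subset {a b c d : ℤ} (h1 : c ≤ a) (h2 : b ≤ d) :
    cellInterval n a b ⊆ cellInterval n c d :=
  Finset.image_subset_image (Finset.Ioc_subset_Ioc h1 h2)

theorem cell_mem_cellInterval {a b m : ℤ} (h1 : a < m) (h2 : m ≤ b) :
    cell n m ∈ cellInterval n a b :=
  Finset.mem_image_of_mem _ (Finset.mem_Ioc.2 ⟨h1, h2⟩)

theorem cell_notMem_cellInterval {a b m : ℤ} (h1 : b < m) (h2 : m ≤ a + n) :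
    cell n m ∉ cellInterval n a b := by
  intro h
  obtain ⟨k, hk, hkm⟩ := Finset.mem_image.1 h
  rw [Finset.mem_Ioc] at hk
  have := cell_inj_of_lt hkm (by omega) (by omega)
  omega

theorem cellInterval_add_period (a b : ℤ) :
    cellInterval n (a + n) (b + n) = cellInterval n a b := by
  unfold cellInterval
  ext x
  simp only [Finset.mem_image, Finset.mem_Ioc]
  constructor
  · rintro ⟨k, hk, rfl⟩
    exact ⟨k - n, by omega, by rw [← cell_add_period, sub_add_cancel]⟩
  · rintro ⟨k, hk, rfl⟩
    exact ⟨k + n, by omega, cell_add_period k⟩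

theorem filter_mem_ringCells (m : ℤ) :
    (Finset.univ.filter fun i : ZMod (2 * n) => cell n m ∈ ringCells i) =
      {dimer n m, dimer n (m + 1), trimer n m, trimer n (m + 1), trimer n (m + 2)} := by
  have hc := val_cell_mod_two (n := n) m
  have e1 : dimer n m = cell n m - 1 := by unfold dimer cell; push_cast; ring
  have e2 : dimer n (m + 1) = cell n m + 1 := by unfold dimer cell; push_cast; ring
  have e3 : trimer n m = cell n m - 2 := by unfold trimer cell; push_cast; ring
  have e4 : trimer n (m + 1) = cell n m := by unfold trimer cell; push_cast; ring
  have e5 : trimer n (m + 2) = cell n m + 2 := by unfold trimer cell; push_cast; ring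
  rw [e1, e2, e3, e4, e5]
  generalize cell n m = c at hc
  have h1 := val_add_one_mod_two c
  have h2 := val_sub_one_mod_two c
  have h3 := val_add_two_mod_two c
  have h4 := val_sub_two_mod_two c
  ext i
  simp only [Finset.mem_filter, Finset.mem_univ, true_and, Finset.mem_insert,
    Finset.mem_singleton]
  unfold ringCells
  rcases Nat.mod_two_eq_zero_or_one i.val with hi | hi
  · rw [hi, if_neg zero_ne_one]
    have a1 : i ≠ c - 2 := by rintro rfl; omega
    have a2 : i ≠ c := by rintro rfl; omega
    have a3 : i ≠ c + 2 := by rintro rfl; omega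
    simp only [Finset.mem_insert, Finset.mem_singleton]
    grind
  · rw [hi, if_pos rfl]
    have a1 : i ≠ c - 1 := by rintro rfl; omega
    have a2 : i ≠ c + 1 := by rintro rfl; omega
    simp only [Finset.mem_insert, Finset.mem_singleton]
    grind

theorem sum_filter_mem_ringCells {R : Type*} [CommRing R] (hn : 5 ≤ n) (m : ℤ)
    (f : ZMod (2 * n) → R) :
    ∑ i with cell n m ∈ ringCells i, f i =
      f (dimer n m) + f (dimer n (m + 1)) + f (trimer n m) + f (trimer n (m + 1)) +
        f (trimer n (m + 2)) := by
  have e2 : (2 : ZMod (2 * n)) ≠ 0 := by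
    exact_mod_cast ofNat_ne_zero_of_lt (n := n) (k := 2) (by omega) (by omega)
  have e4 : (4 : ZMod (2 * n)) ≠ 0 := by
    exact_mod_cast ofNat_ne_zero_of_lt (n := n) (k := 4) (by omega) (by omega)
  have hdt : ∀ k l : ℤ, dimer n k ≠ trimer n l := by
    intro k l h
    have h1 := val_dimer_mod_two (n := n) k
    rw [h, val_trimer_mod_two] at h1
    omega
  have h1 : dimer n m ≠ dimer n (m + 1) := by
    unfold dimer; push_cast; intro h; exact e2 (by linear_combination -h)
  have h2 : trimer n m ≠ trimer n (m + 1) := by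
    unfold trimer; push_cast; intro h; exact e2 (by linear_combination -h)
  have h3 : trimer n m ≠ trimer n (m + 2) := by
    unfold trimer; push_cast; intro h; exact e4 (by linear_combination -h)
  have h4 : trimer n (m + 1) ≠ trimer n (m + 2) := by
    unfold trimer; push_cast; intro h; exact e2 (by linear_combination -h)
  rw [filter_mem_ringCells, Finset.sum_insert, Finset.sum_insert, Finset.sum_insert,
    Finset.sum_insert, Finset.sum_singleton]
  · ring
  all_goals simp [h1, h2, h3, h4, hdt]

end Intervals

/-! ### Recursions for chains of cells and expansions of the ring. -/

section IntervalSums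

variable {R : Type*} [CommRing R] {n : ℕ} [NeZero n]

/-- The partition function of the cells `a + 1, …, b` of the ring. -/
def intervalSum (w : ZMod (2 * n) → R) (a b : ℤ) : R :=
  packingSum ringCells w (cellInterval n a b)

theorem intervalSum_add_period (w : ZMod (2 * n) → R) (a b : ℤ) :
    intervalSum w (a + n) (b + n) = intervalSum w a b := by
  unfold intervalSum
  rw [cellInterval_add_period]

/-- Expansion along the last cell `b`: it is free, or ends a dimer or a trimer. The other three
tiles covering `b` also cover the cell `b + 1`, which is outside because the chain has at most `n -
1` cells. -/
theorem intervalSum_eq_right (hn : 5 ≤ n) (w : ZMod (2 * n) → R) {a b : ℤ} (h1 : 3 ≤ b - a)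
    (h2 : b - a ≤ n - 1) :
    intervalSum w a b = intervalSum w a (b - 1) + w (dimer n b) * intervalSum w a (b - 2) +
      w (trimer n b) * intervalSum w a (b - 3) := by
  have h : cell n (b + 1) ∉ cellInterval n a b := cell_notMem_cellInterval (by omega) (by omega)
  unfold intervalSum
  rw [packingSum_eq_erase_add _ _ _ (cell n b), ← Finset.filter_filter, Finset.sum_filter,
    sum_filter_mem_ringCells hn, Finset.erase_eq, ← cellInterval_singleton, ringCells_dimer,
    ringCells_dimer, ringCells_trimer, ringCells_trimer, ringCells_trimer,
    if_pos (cellInterval_subset (by omega) le_rfl),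
    if_neg fun h' => h (h' (cell_mem_cellInterval (by omega) le_rfl)),
    if_pos (cellInterval_subset (by omega) le_rfl),
    if_neg fun h' => h (h' (cell_mem_cellInterval (by omega) le_rfl)),
    if_neg fun h' => h (h' (cell_mem_cellInterval (by omega) (by omega))),
    cellInterval_sdiff_right (by omega) (by omega),
    cellInterval_sdiff_right (by omega) (by omega),
    cellInterval_sdiff_right (by omega) (by omega)]
  ring

theorem intervalSum_eq_left (hn : 5 ≤ n) (w : ZMod (2 * n) → R) {a b : ℤ} (h1 : 3 ≤ b - a)
    (h2 : b - a ≤ n - 1) :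
    intervalSum w a b = intervalSum w (a + 1) b + w (dimer n (a + 2)) * intervalSum w (a + 2) b +
      w (trimer n (a + 3)) * intervalSum w (a + 3) b := by
  have h : cell n a ∉ cellInterval n a b := by
    rw [← cell_add_period]; exact cell_notMem_cellInterval (by omega) (by omega)
  have hs := cellInterval_singleton (n := n) (a + 1)
  rw [add_sub_cancel_right] at hs
  unfold intervalSum
  rw [packingSum_eq_erase_add _ _ _ (cell n (a + 1)), ← Finset.filter_filter, Finset.sum_filter,
    sum_filter_mem_ringCells hn, Finset.erase_eq, ← hs, ringCells_dimer,
    ringCells_dimer, ringCells_trimer, ringCells_trimer, ringCells_trimer,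
    show a + 1 + 1 = a + 2 by ring, show a + 1 + 2 = a + 3 by ring, add_sub_cancel_right,
    add_sub_cancel_right,
    if_neg fun h' => h (h' (cell_mem_cellInterval (by omega) (by omega))),
    if_pos (cellInterval_subset le_rfl (by omega)),
    if_neg fun h' => h (h' (cell_mem_cellInterval (by omega) (by omega))),
    if_neg fun h' => h (h' (cell_mem_cellInterval (by omega) (by omega))),
    if_pos (cellInterval_subset le_rfl (by omega)),
    cellInterval_sdiff_left (by omega) (by omega),
    cellInterval_sdiff_left (by omega) (by omega),
    cellInterval_sdiff_left (by omega) (by omega)]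
  ring

/-- With the ring cut just before the dimer, its complement is the chain of `n - 2` cells after `m`.
-/
theorem packingSumThrough_dimer (w : ZMod (2 * n) → R) (m : ℤ) :
    packingSumThrough ringCells w Finset.univ (dimer n m) =
      w (dimer n m) * intervalSum w m (m + n - 2) := by
  have h : packingSumThrough ringCells w Finset.univ (dimer n m) =
      packingSumThrough ringCells w (cellInterval n (m - 2) (m - 2 + n)) (dimer n m) := by
    unfold packingSumThrough
    rw [packings_univ]
  rw [h, packingSumThrough_eq _ _ (ringCells_subset _ _), ringCells_dimer,
    cellInterval_sdiff_left (by omega) (by omega), intervalSum,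
    show m - 2 + (n : ℤ) = m + n - 2 by ring]
  rw [ringCells_dimer]
  exact ⟨_, cell_mem_cellInterval (m := m) (by omega) le_rfl⟩

theorem packingSumThrough_trimer (w : ZMod (2 * n) → R) (m : ℤ) :
    packingSumThrough ringCells w Finset.univ (trimer n m) =
      w (trimer n m) * intervalSum w m (m + n - 3) := by
  have h : packingSumThrough ringCells w Finset.univ (trimer n m) =
      packingSumThrough ringCells w (cellInterval n (m - 3) (m - 3 + n)) (trimer n m) := by
    unfold packingSumThrough
    rw [packings_univ]
  rw [h, packingSumThrough_eq _ _ (ringCells_subset _ _), ringCells_trimer,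
    cellInterval_sdiff_left (by omega) (by omega), intervalSum,
    show m - 3 + (n : ℤ) = m + n - 3 by ring]
  rw [ringCells_trimer]
  exact ⟨_, cell_mem_cellInterval (m := m) (by omega) le_rfl⟩

/-- Expansion along the cell `m`. The left side does not depend on `m`, so comparing different `m`
yields the relations that drive `deformation_identity`. -/
theorem packingSum_univ_eq (hn : 5 ≤ n) (w : ZMod (2 * n) → R) (m : ℤ) :
    packingSum ringCells w Finset.univ = intervalSum w m (m + n - 1) +
      (packingSumThrough ringCells w Finset.univ (dimer n m) +
        packingSumThrough ringCells w Finset.univ (dimer n (m + 1)) +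
        packingSumThrough ringCells w Finset.univ (trimer n m) +
        packingSumThrough ringCells w Finset.univ (trimer n (m + 1)) +
        packingSumThrough ringCells w Finset.univ (trimer n (m + 2))) := by
  have h : ∀ i, packingSumThrough ringCells w Finset.univ i =
      packingSumThrough ringCells w (cellInterval n (m - 1) (m - 1 + n)) i := by
    intro i
    unfold packingSumThrough
    rw [packings_univ (m - 1)]
  have h' : packingSum ringCells w Finset.univ =
      packingSum ringCells w (cellInterval n (m - 1) (m - 1 + n)) := by
    unfold packingSum
    rw [packings_univ (m - 1)]
  rw [h', packingSum_eq_erase_add _ _ _ (cell n m), Finset.erase_eq, ← cellInterval_singleton,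
    cellInterval_sdiff_left (by omega) (by omega), intervalSum,
    ← sum_filter_mem_ringCells hn m]
  rw [show m - 1 + (n : ℤ) = m + n - 1 by ring]
  congr 1
  refine Finset.sum_congr ?_ fun i hi => ?_
  · refine Finset.filter_congr fun i _ => and_iff_left ?_
    rw [show m + n - 1 = m - 1 + (n : ℤ) by ring]
    exact ringCells_subset i _
  · rw [h, show m + n - 1 = m - 1 + (n : ℤ) by ring,
      packingSumThrough_eq _ _ (ringCells_subset _ _) ⟨_, (Finset.mem_filter.1 hi).2⟩]

end IntervalSums

/-! ### The deformation of a solution along the Hamiltonian flow -/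

/-- Let `N, C, D, E, F` be the partition functions of the chains of `n - 1, …, n - 5` cells that
start after the cell `k`, and let `e` be a solution of the recursion
`eₘ = eₘ₋₁ + pₘ eₘ₋₂ + qₘ eₘ₋₃`. Then the combination of consecutive values of `e` with the
coefficients `A, B, G` solves the linearized recursion, up to the factor `-(l - 1)`, for the
velocities of `p` and `q` under the Hamiltonian flow. -/
theorem deformation_identity {R : Type*} [CommRing R] (l T : R) (p q N C D E F P Q : ℤ → R)
    (hT : ∀ k, T = N k + (P k + P (k + 1) + Q k + Q (k + 1) + Q (k + 2)))
    (hP : ∀ k, P k = l * p k * C k) (hQ : ∀ k, Q k = l * q k * D k)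
    (hr : ∀ k, N k = C k + l * p (k - 1) * D k + l * q (k - 1) * E k)
    (hr' : ∀ k, C k = D k + l * p (k - 2) * E k + l * q (k - 2) * F k)
    (hl : ∀ k, N k = C (k + 1) + l * p (k + 2) * D (k + 2) + l * q (k + 3) * E (k + 3))
    (hl' : ∀ k, C k = D (k + 1) + l * p (k + 2) * E (k + 2) + l * q (k + 3) * F (k + 3))
    (A B G : ℤ → R) (hA : ∀ k, A k = N k + P k + Q k)
    (hB : ∀ k, B k = l * (p (k + 1) * N (k + 1) + q (k + 2) * C (k + 2)))
    (hG : ∀ k, G k = l * q (k + 1) * N (k + 1))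
    (m : ℤ) (e₀ e₁ e₂ e₃ e₄ e₅ : R) (h₀ : e₀ = e₁ + p m * e₂ + q m * e₃)
    (h₁ : e₁ = e₂ + p (m - 1) * e₃ + q (m - 1) * e₄)
    (h₂ : e₂ = e₃ + p (m - 2) * e₄ + q (m - 2) * e₅) :
    A m * e₀ + B m * e₁ + G m * e₂ -
      (A (m - 1) * e₁ + B (m - 1) * e₂ + G (m - 1) * e₃) -
      p m * (A (m - 2) * e₂ + B (m - 2) * e₃ + G (m - 2) * e₄) -
      q m * (A (m - 3) * e₃ + B (m - 3) * e₄ + G (m - 3) * e₅) =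
    -(l - 1) *
      (p m * (P (m - 1) - P (m + 1) + Q (m - 1) + Q m - Q (m + 1) - Q (m + 2)) * e₂ +
        q m * (P (m - 2) + P (m - 1) - P m - P (m + 1) +
          Q (m - 2) + Q (m - 1) - Q (m + 1) - Q (m + 2)) * e₃) := by
  have i1 : m - 1 + 1 = m := by ring
  have i2 : m - 1 + 2 = m + 1 := by ring
  have i3 : m - 1 + 3 = m + 2 := by ring
  have i4 : m - 2 + 1 = m - 1 := by ring
  have i5 : m - 2 + 2 = m := by ring
  have i6 : m - 2 + 3 = m + 1 := by ring
  have i7 : m - 3 + 1 = m - 2 := by ring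
  have i8 : m - 3 + 2 = m - 1 := by ring
  have i9 : m + 1 - 1 = m := by ring
  have i10 : m + 2 - 2 = m := by ring
  have T0 := hT m
  have T1 := hT (m - 1)
  have T2 := hT (m - 2)
  have T3 := hT (m - 3)
  have f1 := hr (m + 1)
  have f2 := hl (m - 1)
  have f3 := hr' (m + 2)
  have f4 := hl' (m - 1)
  have f5 := hl (m - 2)
  have B1 := hB (m - 1)
  have B2 := hB (m - 2)
  have B3 := hB (m - 3)
  have G1 := hG (m - 1)
  have G2 := hG (m - 2)
  have G3 := hG (m - 3)
  simp only [i1, i2, i3, i4, i5, i6, i7, i8, i9, i10] at T1 T2 T3 f1 f2 f3 f4 f5 B1 B2 B3 G1 G2 G3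
  -- `k1`, `k2`, `k3` concern the coefficients of `e₁`, `e₂`, `e₃` after `e₀`, `e₄`, `e₅` are
  -- eliminated. The first vanishes, since the leading coefficient 1 of the recursion is not
  -- deformed.
  have k1 : A m + B m - A (m - 1) - l * p m * N (m - 1) - l * q m * C (m - 1) = 0 := by
    rw [hA, hA, hB]
    linear_combination T1 - T0 + hP m + hQ m - hP (m + 1) - hQ (m + 2) +
      l * p (m + 1) * f1 + l * q (m + 2) * f3 - l * p m * f2 - l * q m * f4
  -- Equating the expansions of `T` at `m` and `m - 2` shows that `A m - A (m - 2)` is already the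
  -- logarithmic velocity of `p m`; the other terms contribute `-l` times the velocity.
  have k2 : p m * (A m - A (m - 2) + l * N (m - 1)) + G m - B (m - 1) + l * q m * C (m - 1) -
      l * q m * N (m - 2) = -(l - 1) *
      (p m * (P (m - 1) - P (m + 1) + Q (m - 1) + Q m - Q (m + 1) - Q (m + 2))) := by
    rw [hA, hA, B1, hG]
    linear_combination l * q (m + 1) * f1 - l * q m * f5 + p m * (T2 - T0) +
      l * p m * (T0 - T1) + l * p m * (hQ m - hQ (m + 1))
  have k3 : q m * A m - G (m - 1) - p m * B (m - 2) + l * p m * p (m - 1) * N (m - 1) -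
      q m * A (m - 3) + l * q m * p (m - 1) * C (m - 1) + l * q m * N (m - 2) = -(l - 1) *
      (q m * (P (m - 2) + P (m - 1) - P m - P (m + 1) +
          Q (m - 2) + Q (m - 1) - Q (m + 1) - Q (m + 2))) := by
    rw [hA, hA, B2, G1]
    linear_combination q m * (T3 - T0) + l * q m * (T0 - T2) + q m * (hP m - hP (m - 1))
  rw [B3, G2, G3]
  -- The multipliers of `h₁` and `h₂` are forced by the terms in `e₄` and `e₅`.
  linear_combination A m * h₀ + l * (q m * C (m - 1) + p m * N (m - 1)) * h₁ +
    l * q m * N (m - 2) * h₂ + e₁ * k1 + e₂ * k2 + e₃ * k3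

/-! ### Corner invariants in terms of determinants of lifts -/

section Lifts

variable {𝕜 : Type*} [Field 𝕜]

/-- The determinant of three vectors. -/
def det₃ (a b c : Fin 3 → 𝕜) : 𝕜 :=
  a 0 * (b 1 * c 2 - b 2 * c 1) - a 1 * (b 0 * c 2 - b 2 * c 0) + a 2 * (b 0 * c 1 - b 1 * c 0)

theorem linearIndependent_iff_det₃_ne_zero (a b c : Fin 3 → 𝕜) :
    LinearIndependent 𝕜 ![a, b, c] ↔ det₃ a b c ≠ 0 := by
  have h := Matrix.linearIndependent_rows_iff_isUnit (A := Matrix.of ![a, b, c])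
  rw [Matrix.isUnit_iff_isUnit_det, isUnit_iff_ne_zero, Matrix.det_fin_three] at h
  have e : (Matrix.of ![a, b, c]).row = ![a, b, c] := rfl
  rw [e] at h
  rw [h, not_iff_not]
  simp [det₃]
  constructor <;> intro h <;> linear_combination h

theorem linearIndependent_pair_of_det₃_ne_zero {a b c : Fin 3 → 𝕜} (h : det₃ a b c ≠ 0) :
    LinearIndependent 𝕜 ![a, b] := by
  rw [LinearIndependent.pair_iff]
  intro s t hst
  have h0 := congrFun hst 0
  have h1 := congrFun hst 1
  have h2 := congrFun hst 2
  simp only [Pi.add_apply, Pi.smul_apply, smul_eq_mul, Pi.zero_apply] at h0 h1 h2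
  constructor
  · refine (mul_eq_zero.1 (?_ : s * det₃ a b c = 0)).resolve_right h
    unfold det₃
    linear_combination (b 1 * c 2 - b 2 * c 1) * h0 - (b 0 * c 2 - b 2 * c 0) * h1 +
      (b 0 * c 1 - b 1 * c 0) * h2
  · refine (mul_eq_zero.1 (?_ : t * det₃ a b c = 0)).resolve_right h
    unfold det₃
    linear_combination -(a 1 * c 2 - a 2 * c 1) * h0 + (a 0 * c 2 - a 2 * c 0) * h1 -
      (a 0 * c 1 - a 1 * c 0) * h2

/-- Modulo the plane of `P` and `Q` the vector `X` survives, and `R` gives a relation between `X`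
and `Y`; this fixes the ratio of the `X`- and `Y`-coefficients of any common vector. -/
theorem span_pair_inf_span_pair {P Q X Y R : Fin 3 → 𝕜} {r₁ r₂ x₁ x₂ : 𝕜}
    (hdet : det₃ P Q X ≠ 0) (hx : x₂ ≠ 0) (h₁ : R = r₁ • P + r₂ • Q) (h₂ : R = x₁ • X + x₂ • Y) :
    ((𝕜 ∙ P) ⊔ (𝕜 ∙ Q)) ⊓ ((𝕜 ∙ X) ⊔ (𝕜 ∙ Y)) = 𝕜 ∙ R := by
  rw [← Submodule.span_insert, ← Submodule.span_insert]
  ext z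
  rw [Submodule.mem_inf, Submodule.mem_span_pair, Submodule.mem_span_pair,
    Submodule.mem_span_singleton]
  constructor
  · rintro ⟨⟨α, β, h⟩, γ, δ, h'⟩
    refine ⟨δ / x₂, ?_⟩
    have key : γ * x₂ = δ * x₁ := by
      refine mul_right_cancel₀ hdet ?_
      have e (i) := congrFun (h.trans h'.symm) i
      have f (i) := congrFun (h₁.symm.trans h₂) i
      simp only [Pi.add_apply, Pi.smul_apply, smul_eq_mul] at e f
      unfold det₃
      linear_combination
        (P 1 * Q 2 - P 2 * Q 1) * (δ * f 0 - x₂ * e 0) -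
        (P 0 * Q 2 - P 2 * Q 0) * (δ * f 1 - x₂ * e 1) +
        (P 0 * Q 1 - P 1 * Q 0) * (δ * f 2 - x₂ * e 2)
    rw [← h', h₂, smul_add, smul_smul, smul_smul, div_mul_cancel₀ _ hx]
    congr 2
    field_simp
    linear_combination -key
  · rintro ⟨t, rfl⟩
    exact ⟨⟨t * r₁, t * r₂, by rw [h₁, smul_add, smul_smul, smul_smul]⟩,
      t * x₁, t * x₂, by rw [h₂, smul_add, smul_smul, smul_smul]⟩

theorem eq_smul_of_span_singleton_eq {a b : Fin 3 → 𝕜} (h : (𝕜 ∙ a) = 𝕜 ∙ b) :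
    ∃ c : 𝕜, a = c • b := by
  obtain ⟨c, hc⟩ := Submodule.mem_span_singleton.1 (h ▸ Submodule.mem_span_singleton_self a)
  exact ⟨c, hc.symm⟩

/-- The cross ratio does not depend on the affine parameter, and in homogeneous coordinates along
`P, Q` the four points are `(1:0), (0:1), (r₁:r₂), (s₁:s₂)`. -/
theorem isInvCrossRatio_iff [Infinite 𝕜] {P Q : Fin 3 → 𝕜} (hPQ : LinearIndependent 𝕜 ![P, Q])
    {r₁ r₂ s₁ s₂ : 𝕜} (hr : r₂ ≠ 0) (hs : s₁ ≠ 0) (r : 𝕜) :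
    IsInvCrossRatio (𝕜 ∙ P) (𝕜 ∙ Q) (𝕜 ∙ (r₁ • P + r₂ • Q)) (𝕜 ∙ (s₁ • P + s₂ • Q)) r ↔
      r = 1 - r₁ * s₂ / (r₂ * s₁) := by
  have hPQ' := LinearIndependent.pair_iff.1 hPQ
  constructor
  · rintro ⟨a, b, t₁, t₂, t₃, t₄, -, hA, hB, hC, hD, h13, h24, rfl⟩
    obtain ⟨c₁, hc₁⟩ := eq_smul_of_span_singleton_eq hA.symm
    obtain ⟨c₂, hc₂⟩ := eq_smul_of_span_singleton_eq hB.symm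
    obtain ⟨c₃, hc₃⟩ := eq_smul_of_span_singleton_eq hC.symm
    obtain ⟨c₄, hc₄⟩ := eq_smul_of_span_singleton_eq hD.symm
    have h12 : t₁ ≠ t₂ := by
      rintro rfl
      have h := hPQ' c₁ (-c₂) (by rw [neg_smul, ← hc₁, ← hc₂, add_neg_cancel])
      have h0 : a + t₁ • b = 0 := by rw [hc₁, h.1, zero_smul]
      have hP : P = 0 := by
        obtain ⟨c, hc⟩ := eq_smul_of_span_singleton_eq hA
        rw [hc, h0, smul_zero]
      simpa using (hPQ' 1 0 (by rw [hP]; simp)).1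
    -- Affine interpolation: `(t₂ - t₁) • (a + t • b)` is a combination of the points with
    -- parameters `t₁` and `t₂`.
    have rel : ∀ {c u₁ u₂ t : 𝕜}, a + t • b = c • (u₁ • P + u₂ • Q) →
        c * u₁ * (t₂ - t₁) = c₁ * (t₂ - t) ∧ c * u₂ * (t₂ - t₁) = c₂ * (t - t₁) := by
      intro c u₁ u₂ t h
      have h' : (c * u₁ * (t₂ - t₁) - c₁ * (t₂ - t)) • P +
          (c * u₂ * (t₂ - t₁) - c₂ * (t - t₁)) • Q = 0 := by
        have e : (t₂ - t₁) • (c • (u₁ • P + u₂ • Q)) =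
            (t₂ - t) • (c₁ • P) + (t - t₁) • (c₂ • Q) := by
          rw [← h, ← hc₁, ← hc₂]
          module
        have : (c * u₁ * (t₂ - t₁) - c₁ * (t₂ - t)) • P +
          (c * u₂ * (t₂ - t₁) - c₂ * (t - t₁)) • Q =
            (t₂ - t₁) • (c • (u₁ • P + u₂ • Q)) -
            ((t₂ - t) • (c₁ • P) + (t - t₁) • (c₂ • Q)) := by module
        rw [this, e, sub_self]
      obtain ⟨h1, h2⟩ := hPQ' _ _ h'
      exact ⟨sub_eq_zero.1 h1, sub_eq_zero.1 h2⟩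
    obtain ⟨a1, a2⟩ := rel hc₃
    obtain ⟨b1, b2⟩ := rel hc₄
    have n12 : t₂ - t₁ ≠ 0 := sub_ne_zero.2 h12.symm
    have n13 : t₁ - t₃ ≠ 0 := sub_ne_zero.2 h13
    have n24 : t₂ - t₄ ≠ 0 := sub_ne_zero.2 h24
    have ne_of : ∀ {c t : 𝕜} (v : Fin 3 → 𝕜), a + t • b = c • v → v ≠ 0 →
        (𝕜 ∙ v) = 𝕜 ∙ (a + t • b) → c ≠ 0 := by
      rintro c t v h hv h' rfl
      rw [zero_smul] at h
      rw [h, Submodule.span_singleton_eq_bot.2 rfl, Submodule.span_singleton_eq_bot] at h'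
      exact hv h'
    have hc3 : c₃ ≠ 0 := ne_of _ hc₃ (fun h => hr (hPQ' _ _ h).2) hC
    have hc4 : c₄ ≠ 0 := ne_of _ hc₄ (fun h => hs (hPQ' _ _ h).1) hD
    have hc1 : c₁ ≠ 0 := by
      rintro rfl
      rw [zero_mul] at b1
      exact mul_ne_zero (mul_ne_zero hc4 hs) n12 b1
    have hc2 : c₂ ≠ 0 := by
      rintro rfl
      rw [zero_mul] at a2
      exact mul_ne_zero (mul_ne_zero hc3 hr) n12 a2
    have e1 : r₁ = c₁ * (t₂ - t₃) / (c₃ * (t₂ - t₁)) := by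
      rw [eq_div_iff (mul_ne_zero hc3 n12)]; linear_combination a1
    have e2 : r₂ = c₂ * (t₃ - t₁) / (c₃ * (t₂ - t₁)) := by
      rw [eq_div_iff (mul_ne_zero hc3 n12)]; linear_combination a2
    have e3 : s₁ = c₁ * (t₂ - t₄) / (c₄ * (t₂ - t₁)) := by
      rw [eq_div_iff (mul_ne_zero hc4 n12)]; linear_combination b1
    have e4 : s₂ = c₂ * (t₄ - t₁) / (c₄ * (t₂ - t₁)) := by
      rw [eq_div_iff (mul_ne_zero hc4 n12)]; linear_combination b2
    have n31 : t₃ - t₁ ≠ 0 := sub_ne_zero.2 h13.symm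
    rw [e1, e2, e3, e4]
    rw [show t₁ - t₃ = -(t₃ - t₁) by ring]
    field_simp
    ring
  · rintro rfl
    classical
    -- The parameter will be 0 at `P`, 1 at `Q` and infinite at `Q - c P`. The excluded values of
    -- `c` would send `Q` or one of the last two points to infinity.
    obtain ⟨c, hc⟩ := Infinite.exists_notMem_finset
      ({0, -r₁ / r₂, -s₁ / s₂} : Finset 𝕜)
    simp only [Finset.mem_insert, Finset.mem_singleton, not_or] at hc
    obtain ⟨hc0, hcr, hcs⟩ := hc
    have h3 : r₁ + r₂ * c ≠ 0 := fun h => hcr (by rw [eq_div_iff hr]; linear_combination h)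
    have h4 : s₁ + s₂ * c ≠ 0 := by
      intro h
      by_cases h0 : s₂ = 0
      · rw [h0, zero_mul, add_zero] at h
        exact hs h
      · exact hcs (by rw [eq_div_iff h0]; linear_combination h)
    have hspan : ∀ (k : 𝕜) (u v : Fin 3 → 𝕜), k ≠ 0 → u = k • v → (𝕜 ∙ u) = 𝕜 ∙ v := by
      rintro k u v hk rfl
      exact Submodule.span_singleton_smul_eq (isUnit_iff_ne_zero.2 hk) v
    refine ⟨P, c⁻¹ • Q - P, 0, 1, r₂ * c / (r₁ + r₂ * c), s₂ * c / (s₁ + s₂ * c), ?_, ?_, ?_, ?_,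
      ?_, ?_, ?_, ?_⟩
    · rw [LinearIndependent.pair_iff]
      intro s t h
      have h' := hPQ' (s - t) (t * c⁻¹) (by rw [← h]; module)
      have ht : t = 0 := (mul_eq_zero.1 h'.2).resolve_right (inv_ne_zero hc0)
      exact ⟨(sub_eq_zero.1 h'.1).trans ht, ht⟩
    · simp
    · refine hspan c _ _ hc0 ?_
      rw [one_smul, add_sub_cancel, smul_smul, mul_inv_cancel₀ hc0, one_smul]
    · refine hspan (r₁ + r₂ * c) _ _ h3 ?_
      (match_scalars <;> field_simp); ring
    · refine hspan (s₁ + s₂ * c) _ _ h4 ?_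
      (match_scalars <;> field_simp); ring
    · exact (div_ne_zero (mul_ne_zero hr hc0) h3).symm
    · intro h
      rw [eq_div_iff h4] at h
      exact hs (by linear_combination h)
    · have e : s₁ + s₂ * c - s₂ * c = s₁ := by ring
      have e1 : 1 - s₂ * c / (s₁ + s₂ * c) = s₁ / (s₁ + s₂ * c) := by field_simp; ring
      rw [e1]
      field_simp
      ring

end Lifts

/-! ### Lifted polygons -/

section Recurrence

variable {𝕜 : Type*} [Field 𝕜]

/-- No three of any four consecutive vectors are linearly dependent. -/
def IsGeneric (V : ℤ → Fin 3 → 𝕜) : Prop :=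
  ∀ m, det₃ (V (m - 3)) (V (m - 2)) (V (m - 1)) ≠ 0 ∧ det₃ (V (m - 3)) (V (m - 2)) (V m) ≠ 0 ∧
    det₃ (V (m - 3)) (V m) (V (m - 1)) ≠ 0 ∧ det₃ (V m) (V (m - 2)) (V (m - 1)) ≠ 0

/-- The coefficient of `V (m - 1)` in the expansion of `V m` in the three preceding vectors. -/
def coeffA (V : ℤ → Fin 3 → 𝕜) (m : ℤ) : 𝕜 :=
  det₃ (V (m - 3)) (V (m - 2)) (V m) / det₃ (V (m - 3)) (V (m - 2)) (V (m - 1))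

/-- The coefficient of `V (m - 2)` in the expansion of `V m` in the three preceding vectors. -/
def coeffB (V : ℤ → Fin 3 → 𝕜) (m : ℤ) : 𝕜 :=
  det₃ (V (m - 3)) (V m) (V (m - 1)) / det₃ (V (m - 3)) (V (m - 2)) (V (m - 1))

/-- The coefficient of `V (m - 3)` in the expansion of `V m` in the three preceding vectors. -/
def coeffC (V : ℤ → Fin 3 → 𝕜) (m : ℤ) : 𝕜 :=
  det₃ (V m) (V (m - 2)) (V (m - 1)) / det₃ (V (m - 3)) (V (m - 2)) (V (m - 1))

theorem IsGeneric.coeffA_ne_zero {V : ℤ → Fin 3 → 𝕜} (hV : IsGeneric V) (m : ℤ) :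
    coeffA V m ≠ 0 :=
  div_ne_zero (hV m).2.1 (hV m).1

theorem IsGeneric.coeffB_ne_zero {V : ℤ → Fin 3 → 𝕜} (hV : IsGeneric V) (m : ℤ) :
    coeffB V m ≠ 0 :=
  div_ne_zero (hV m).2.2.1 (hV m).1

theorem IsGeneric.coeffC_ne_zero {V : ℤ → Fin 3 → 𝕜} (hV : IsGeneric V) (m : ℤ) :
    coeffC V m ≠ 0 :=
  div_ne_zero (hV m).2.2.2 (hV m).1

/-- Cramer's rule. -/
theorem eq_coeff_smul_add {V : ℤ → Fin 3 → 𝕜} {m : ℤ}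
    (h : det₃ (V (m - 3)) (V (m - 2)) (V (m - 1)) ≠ 0) :
    V m = coeffA V m • V (m - 1) + coeffB V m • V (m - 2) + coeffC V m • V (m - 3) := by
  unfold coeffA coeffB coeffC
  ext i
  simp only [Pi.add_apply, Pi.smul_apply, smul_eq_mul]
  field_simp
  unfold det₃
  fin_cases i <;> simp only [Fin.zero_eta, Fin.mk_one, Fin.reduceFinMk, Fin.isValue] <;> ring

theorem IsGeneric.eq_coeff {V : ℤ → Fin 3 → 𝕜} (hV : IsGeneric V) (m : ℤ) :
    V m = coeffA V m • V (m - 1) + coeffB V m • V (m - 2) + coeffC V m • V (m - 3) :=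
  eq_coeff_smul_add (hV m).1

/-- The corner invariant with index `2 i`. -/
def cornerEven (V : ℤ → Fin 3 → 𝕜) (i : ℤ) : 𝕜 :=
  -coeffB V (i + 2) / (coeffA V (i + 2) * coeffA V (i + 1))

/-- The corner invariant with index `2 i - 1`. -/
def cornerOdd (V : ℤ → Fin 3 → 𝕜) (i : ℤ) : 𝕜 :=
  coeffA V (i + 1) * coeffC V (i + 2) / (coeffB V (i + 1) * coeffB V (i + 2))

/-- The first intersection point is `V₁ - a U`; eliminating `U` between the two relations gives the
second, `a V₂ - (a a' + b') V₁`. -/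
theorem isInvCrossRatio_cornerOdd [Infinite 𝕜] {P Q U V₁ V₂ : Fin 3 → 𝕜} {a b c a' b' c' : 𝕜}
    (hdet : det₃ P Q U ≠ 0) (ha : a ≠ 0) (hb : b ≠ 0) (hc : c ≠ 0) (hb' : b' ≠ 0)
    (h₁ : V₁ = a • U + b • Q + c • P) (h₂ : V₂ = a' • V₁ + b' • U + c' • Q) (r : 𝕜) :
    IsInvCrossRatio (𝕜 ∙ P) (𝕜 ∙ Q) (((𝕜 ∙ P) ⊔ (𝕜 ∙ Q)) ⊓ ((𝕜 ∙ U) ⊔ (𝕜 ∙ V₁)))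
      (((𝕜 ∙ P) ⊔ (𝕜 ∙ Q)) ⊓ ((𝕜 ∙ V₁) ⊔ (𝕜 ∙ V₂))) r ↔ r = a * c' / (b * b') := by
  have hdet' : det₃ P Q V₁ ≠ 0 := by
    have : det₃ P Q V₁ = a * det₃ P Q U := by
      rw [h₁]; simp only [det₃, Pi.add_apply, Pi.smul_apply, smul_eq_mul]; ring
    rw [this]
    exact mul_ne_zero ha hdet
  rw [span_pair_inf_span_pair (R := c • P + b • Q) (r₁ := c) (r₂ := b) (x₁ := -a) (x₂ := 1) hdet
      one_ne_zero rfl (by rw [h₁]; module),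
    span_pair_inf_span_pair (R := (-(b' * c)) • P + (a * c' - b * b') • Q) (r₁ := -(b' * c))
      (r₂ := a * c' - b * b') (x₁ := -(a * a' + b')) (x₂ := a) hdet' ha rfl
      (by rw [h₂, h₁]; module),
    isInvCrossRatio_iff (linearIndependent_pair_of_det₃_ne_zero hdet) hb
      (neg_ne_zero.2 (mul_ne_zero hb' hc))]
  rw [show 1 - c * (a * c' - b * b') / (b * -(b' * c)) = a * c' / (b * b') by field_simp; ring]

/-- The intersection points are `P - a Q` and, after elimination of `U`, `b Q - a' (P - a Q)`. -/
theorem isInvCrossRatio_cornerEven [Infinite 𝕜] {P Q U Y₁ Y₂ : Fin 3 → 𝕜} {a b c a' b' c' : 𝕜}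
    (hdet : det₃ Y₁ U Q ≠ 0) (ha : a ≠ 0) (hb : b ≠ 0) (hc : c ≠ 0) (ha' : a' ≠ 0) (hc' : c' ≠ 0)
    (h₁ : P = a • Q + b • U + c • Y₁) (h₂ : Q = a' • U + b' • Y₁ + c' • Y₂) (r : 𝕜) :
    IsInvCrossRatio (𝕜 ∙ P) (𝕜 ∙ Q) (((𝕜 ∙ P) ⊔ (𝕜 ∙ Q)) ⊓ ((𝕜 ∙ U) ⊔ (𝕜 ∙ Y₁)))
      (((𝕜 ∙ P) ⊔ (𝕜 ∙ Q)) ⊓ ((𝕜 ∙ Y₁) ⊔ (𝕜 ∙ Y₂))) r ↔ r = -b / (a * a') := by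
  have hdetU : det₃ P Q U ≠ 0 := by
    have : det₃ P Q U = -c * det₃ Y₁ U Q := by
      rw [h₁]; simp only [det₃, Pi.add_apply, Pi.smul_apply, smul_eq_mul]; ring
    rw [this]
    exact mul_ne_zero (neg_ne_zero.2 hc) hdet
  have hdetY : det₃ P Q Y₁ ≠ 0 := by
    have : det₃ P Q Y₁ = b * det₃ Y₁ U Q := by
      rw [h₁]; simp only [det₃, Pi.add_apply, Pi.smul_apply, smul_eq_mul]; ring
    rw [this]
    exact mul_ne_zero hb hdet
  rw [span_pair_inf_span_pair (R := (1 : 𝕜) • P + (-a) • Q) (r₁ := 1) (r₂ := -a) (x₁ := b)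
      (x₂ := c) hdetU hc rfl (by rw [h₁]; module),
    span_pair_inf_span_pair (R := (-a') • P + (b + a * a') • Q) (r₁ := -a')
      (r₂ := b + a * a') (x₁ := b * b' - a' * c) (x₂ := b * c') hdetY (mul_ne_zero hb hc') rfl
      (by
        have : (-a') • P + (b + a * a') • Q = b • Q - a' • (b • U + c • Y₁) := by
          rw [h₁]; module
        rw [this, h₂]; module),
    isInvCrossRatio_iff (linearIndependent_pair_of_det₃_ne_zero hdetU) (neg_ne_zero.2 ha)
      (neg_ne_zero.2 ha')]
  rw [show 1 - 1 * (b + a * a') / (-a * -a') = -b / (a * a') by field_simp; ring]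

/-- `V` is a lift of the polygon `v`. -/
def IsLift (V : ℤ → Fin 3 → 𝕜) (v : ℤ → ℙ 𝕜 (Fin 3 → 𝕜)) : Prop :=
  ∀ i, ∃ h : V i ≠ 0, v i = Projectivization.mk 𝕜 (V i) h

theorem IsLift.independent_iff {V : ℤ → Fin 3 → 𝕜} {v : ℤ → ℙ 𝕜 (Fin 3 → 𝕜)} (h : IsLift V v)
    (i j k : ℤ) :
    Projectivization.Independent ![v i, v j, v k] ↔ det₃ (V i) (V j) (V k) ≠ 0 := by
  obtain ⟨hi, hi'⟩ := h i
  obtain ⟨hj, hj'⟩ := h j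
  obtain ⟨hk, hk'⟩ := h k
  rw [← linearIndependent_iff_det₃_ne_zero]
  constructor
  · intro H
    rw [Projectivization.independent_iff] at H
    obtain ⟨a, ha⟩ := Projectivization.exists_smul_eq_mk_rep 𝕜 (V i) hi
    obtain ⟨b, hb⟩ := Projectivization.exists_smul_eq_mk_rep 𝕜 (V j) hj
    obtain ⟨c, hc⟩ := Projectivization.exists_smul_eq_mk_rep 𝕜 (V k) hk
    have e : ![V i, V j, V k] =
        ![a⁻¹, b⁻¹, c⁻¹] • (Projectivization.rep ∘ ![v i, v j, v k]) := by
      ext l : 1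
      fin_cases l
      · simp [hi', ← ha]
      · simp [hj', ← hb]
      · simp [hk', ← hc]
    rw [e]
    exact H.units_smul _
  · intro H
    have := Projectivization.Independent.mk ![V i, V j, V k]
      (by intro l; fin_cases l <;> assumption) H
    convert this using 1
    ext l : 1
    fin_cases l
    · simp [hi']
    · simp [hj']
    · simp [hk']

theorem det₃_swap_right (a b c : Fin 3 → 𝕜) : det₃ a b c = -det₃ a c b := by
  unfold det₃; ring

theorem det₃_rotate (a b c : Fin 3 → 𝕜) : det₃ a b c = det₃ b c a := by
  unfold det₃; ring

theorem IsLift.inGeneralPosition_iff {V : ℤ → Fin 3 → 𝕜} {v : ℤ → ℙ 𝕜 (Fin 3 → 𝕜)}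
    (h : IsLift V v) : InGeneralPosition v ↔ IsGeneric V := by
  unfold InGeneralPosition IsGeneric
  simp only [h.independent_iff]
  constructor
  · intro H m
    obtain ⟨h1, h2, h3, h4⟩ := H (m - 3)
    rw [show m - 3 + 1 = m - 2 by ring, show m - 3 + 2 = m - 1 by ring,
      show m - 3 + 3 = m by ring] at *
    refine ⟨h1, h2, ?_, ?_⟩
    · rw [det₃_swap_right]; exact neg_ne_zero.2 h3
    · rw [det₃_rotate]; exact h4
  · intro H i
    obtain ⟨h1, h2, h3, h4⟩ := H (i + 3)
    rw [show i + 3 - 3 = i by ring, show i + 3 - 2 = i + 1 by ring,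
      show i + 3 - 1 = i + 2 by ring] at *
    refine ⟨h1, h2, ?_, ?_⟩
    · rw [det₃_swap_right]; exact neg_ne_zero.2 h3
    · rw [← det₃_rotate]; exact h4

theorem IsLift.submodule_eq {V : ℤ → Fin 3 → 𝕜} {v : ℤ → ℙ 𝕜 (Fin 3 → 𝕜)} (h : IsLift V v)
    (i : ℤ) : (v i).submodule = 𝕜 ∙ V i := by
  obtain ⟨hi, hi'⟩ := h i
  rw [hi', Projectivization.submodule_mk]

theorem IsLift.hasCornerInvariants_iff [Infinite 𝕜] {n : ℕ} {V : ℤ → Fin 3 → 𝕜}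
    {v : ℤ → ℙ 𝕜 (Fin 3 → 𝕜)} (h : IsLift V v) (hV : IsGeneric V) (x : ZMod (2 * n) → 𝕜) :
    HasCornerInvariants n v x ↔ ∀ i : ℤ, x ((2 * i - 1 : ℤ) : ZMod (2 * n)) = cornerOdd V i ∧
      x ((2 * i : ℤ) : ZMod (2 * n)) = cornerEven V i := by
  unfold HasCornerInvariants lineThrough
  simp only [h.submodule_eq]
  refine forall_congr' fun i => ?_
  have e1 := hV.eq_coeff (i + 1)
  have e2 := hV.eq_coeff (i + 2)
  have d1 := (hV (i + 1)).1
  have d2 := (hV (i + 2)).1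
  simp only [show i + 1 - 1 = i by ring, show i + 1 - 2 = i - 1 by ring,
    show i + 1 - 3 = i - 2 by ring, show i + 2 - 1 = i + 1 by ring, show i + 2 - 2 = i by ring,
    show i + 2 - 3 = i - 1 by ring] at e1 e2 d1 d2
  refine and_congr ?_ ?_
  · exact isInvCrossRatio_cornerOdd d1 (hV.coeffA_ne_zero _) (hV.coeffB_ne_zero _)
      (hV.coeffC_ne_zero _) (hV.coeffB_ne_zero _) e1 e2 _
  · exact isInvCrossRatio_cornerEven d2 (hV.coeffA_ne_zero _) (hV.coeffB_ne_zero _)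
      (hV.coeffC_ne_zero _) (hV.coeffA_ne_zero _) (hV.coeffC_ne_zero _) e2 e1 _

/-- A tuple consists of the corner coordinates of a closed polygon iff the latter can be lifted
to a periodic sequence of vectors. -/
theorem mem_closedSpace_iff [Infinite 𝕜] {n : ℕ} (x : ZMod (2 * n) → 𝕜) :
    x ∈ closedSpace 𝕜 n ↔ ∃ V : ℤ → Fin 3 → 𝕜, (∀ i, V (i + n) = V i) ∧ IsGeneric V ∧
      ∀ i : ℤ, x ((2 * i - 1 : ℤ) : ZMod (2 * n)) = cornerOdd V i ∧
        x ((2 * i : ℤ) : ZMod (2 * n)) = cornerEven V i := by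
  constructor
  · rintro ⟨v, hv, hg, hx⟩
    -- With trivial monodromy `v` itself is periodic, so choosing a representative of each point
    -- gives a periodic lift.
    have hl : IsLift (fun i => (v i).rep) v :=
      fun i => ⟨(v i).rep_nonzero, (v i).mk_rep.symm⟩
    have hV := hl.inGeneralPosition_iff.1 hg
    refine ⟨fun i => (v i).rep, fun i => ?_, hV, (hl.hasCornerInvariants_iff hV x).1 hx⟩
    simp only
    rw [hv i, one_smul]
  · rintro ⟨V, hp, hV, hx⟩
    have h0 : ∀ i, V i ≠ 0 := by
      intro i h
      have := (hV i).2.1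
      rw [h] at this
      simp [det₃] at this
    have hl : IsLift V (fun i => Projectivization.mk 𝕜 (V i) (h0 i)) := fun i => ⟨h0 i, rfl⟩
    refine ⟨_, fun i => ?_, hl.inGeneralPosition_iff.2 hV, (hl.hasCornerInvariants_iff hV x).2 hx⟩
    rw [one_smul]
    simp only [hp]

end Recurrence

/-! ### Corner coordinates of a periodic lift -/

section CornerMap

variable {𝕜 : Type*} [Field 𝕜] {n : ℕ} [NeZero n]

theorem coeffA_periodic {V : ℤ → Fin 3 → 𝕜} (hV : Function.Periodic V n) :
    Function.Periodic (coeffA V) n := by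
  intro m
  unfold coeffA
  rw [show m + (n : ℤ) - 3 = m - 3 + n by ring, show m + (n : ℤ) - 2 = m - 2 + n by ring,
    show m + (n : ℤ) - 1 = m - 1 + n by ring, hV, hV, hV, hV]

theorem coeffB_periodic {V : ℤ → Fin 3 → 𝕜} (hV : Function.Periodic V n) :
    Function.Periodic (coeffB V) n := by
  intro m
  unfold coeffB
  rw [show m + (n : ℤ) - 3 = m - 3 + n by ring, show m + (n : ℤ) - 2 = m - 2 + n by ring,
    show m + (n : ℤ) - 1 = m - 1 + n by ring, hV, hV, hV, hV]

theorem coeffC_periodic {V : ℤ → Fin 3 → 𝕜} (hV : Function.Periodic V n) :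
    Function.Periodic (coeffC V) n := by
  intro m
  unfold coeffC
  rw [show m + (n : ℤ) - 3 = m - 3 + n by ring, show m + (n : ℤ) - 2 = m - 2 + n by ring,
    show m + (n : ℤ) - 1 = m - 1 + n by ring, hV, hV, hV, hV]

theorem cornerEven_periodic {V : ℤ → Fin 3 → 𝕜} (hV : Function.Periodic V n) :
    Function.Periodic (cornerEven V) n := by
  intro i
  unfold cornerEven
  rw [show i + (n : ℤ) + 2 = i + 2 + n by ring, show i + (n : ℤ) + 1 = i + 1 + n by ring,
    coeffA_periodic hV, coeffA_periodic hV, coeffB_periodic hV]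

theorem cornerOdd_periodic {V : ℤ → Fin 3 → 𝕜} (hV : Function.Periodic V n) :
    Function.Periodic (cornerOdd V) n := by
  intro i
  unfold cornerOdd
  rw [show i + (n : ℤ) + 2 = i + 2 + n by ring, show i + (n : ℤ) + 1 = i + 1 + n by ring,
    coeffA_periodic hV, coeffC_periodic hV, coeffB_periodic hV, coeffB_periodic hV]

/-- The corner coordinates of a lifted polygon. -/
def cornerMap (n : ℕ) (V : ℤ → Fin 3 → 𝕜) (j : ZMod (2 * n)) : 𝕜 :=
  if j.val % 2 = 0 then cornerEven V (j.val / 2 : ℤ) else cornerOdd V ((j.val + 1) / 2 : ℤ)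

theorem cornerMap_even {V : ℤ → Fin 3 → 𝕜} (hV : Function.Periodic V n) (i : ℤ) :
    cornerMap n V ((2 * i : ℤ) : ZMod (2 * n)) = cornerEven V i := by
  have hp := val_intCast_mod_two (n := n) (2 * i)
  have hv := ZMod.val_intCast (n := 2 * n) (2 * i)
  unfold cornerMap
  rw [if_pos (by omega), hv]
  push_cast
  rw [Int.mul_emod_mul_of_pos _ _ two_pos, Int.mul_ediv_cancel_left _ two_ne_zero]
  rw [show i % n = i - i / n * n by linear_combination Int.mul_ediv_add_emod i n]
  exact (cornerEven_periodic hV).sub_int_mul_eq _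

theorem cornerMap_odd {V : ℤ → Fin 3 → 𝕜} (hV : Function.Periodic V n) (i : ℤ) :
    cornerMap n V ((2 * i - 1 : ℤ) : ZMod (2 * n)) = cornerOdd V i := by
  have hp := val_intCast_mod_two (n := n) (2 * i - 1)
  have hv := ZMod.val_intCast (n := 2 * n) (2 * i - 1)
  unfold cornerMap
  rw [if_neg (by omega)]
  have h1 := Int.mul_ediv_add_emod (2 * i - 1) ((2 * n : ℕ) : ℤ)
  rw [← hv] at h1
  push_cast at h1
  set k := (2 * i - 1) / (2 * (n : ℤ)) with hk
  have h2 : ((((2 * i - 1 : ℤ) : ZMod (2 * n)).val : ℤ) + 1) / 2 = i - k * n := by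
    have h3 : 2 * (n : ℤ) * k = 2 * (k * n) := by ring
    push_cast
    omega
  rw [h2]
  exact (cornerOdd_periodic hV).sub_int_mul_eq k

theorem cornerMap_mem_closedSpace [Infinite 𝕜] {V : ℤ → Fin 3 → 𝕜}
    (hV : Function.Periodic V n) (hg : IsGeneric V) : cornerMap n V ∈ closedSpace 𝕜 n :=
  (mem_closedSpace_iff _).2 ⟨V, hV, hg, fun i => ⟨cornerMap_odd hV i, cornerMap_even hV i⟩⟩

theorem exists_lift_of_mem_closedSpace [Infinite 𝕜] {x : ZMod (2 * n) → 𝕜}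
    (hx : x ∈ closedSpace 𝕜 n) :
    ∃ V : ℤ → Fin 3 → 𝕜, Function.Periodic V n ∧ IsGeneric V ∧ x = cornerMap n V := by
  obtain ⟨V, hV, hg, h⟩ := (mem_closedSpace_iff x).1 hx
  refine ⟨V, hV, hg, ?_⟩
  funext j
  rcases eq_dimer_or_eq_trimer j with ⟨m, rfl⟩ | ⟨m, rfl⟩
  · rw [dimer, show 2 * m - 4 = 2 * (m - 2) by ring, (h _).2, cornerMap_even hV]
  · rw [trimer, show 2 * m - 5 = 2 * (m - 2) - 1 by ring, (h _).1, cornerMap_odd hV]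

theorem cornerMap_dimer {V : ℤ → Fin 3 → 𝕜} (hV : Function.Periodic V n) (m : ℤ) :
    cornerMap n V (dimer n m) = -coeffB V m / (coeffA V m * coeffA V (m - 1)) := by
  rw [dimer, show 2 * m - 4 = 2 * (m - 2) by ring, cornerMap_even hV, cornerEven,
    sub_add_cancel, show m - 2 + 1 = m - 1 by ring]

theorem cornerMap_trimer {V : ℤ → Fin 3 → 𝕜} (hV : Function.Periodic V n) (m : ℤ) :
    cornerMap n V (trimer n m) =
      coeffA V (m - 1) * coeffC V m / (coeffB V (m - 1) * coeffB V m) := by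
  rw [trimer, show 2 * m - 5 = 2 * (m - 2) - 1 by ring, cornerMap_odd hV, cornerOdd,
    sub_add_cancel, show m - 2 + 1 = m - 1 by ring]

theorem cornerMap_ne_zero {V : ℤ → Fin 3 → 𝕜} (hV : Function.Periodic V n) (hg : IsGeneric V)
    (j : ZMod (2 * n)) : cornerMap n V j ≠ 0 := by
  rcases eq_dimer_or_eq_trimer j with ⟨m, rfl⟩ | ⟨m, rfl⟩
  · rw [cornerMap_dimer hV]
    exact div_ne_zero (neg_ne_zero.2 (hg.coeffB_ne_zero _))
      (mul_ne_zero (hg.coeffA_ne_zero _) (hg.coeffA_ne_zero _))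
  · rw [cornerMap_trimer hV]
    exact div_ne_zero (mul_ne_zero (hg.coeffA_ne_zero _) (hg.coeffC_ne_zero _))
      (mul_ne_zero (hg.coeffB_ne_zero _) (hg.coeffB_ne_zero _))

/-- The velocities of the corner coordinates under those first-order deformations `V + t W` of
the lifted polygon `V` which keep it periodic and do not change the coefficients `coeffA`. -/
def deformationSpace (n : ℕ) [NeZero n] (V : ℤ → Fin 3 → 𝕜) :
    Submodule 𝕜 (ZMod (2 * n) → 𝕜) where
  -- With `coeffA` fixed, `coeffB` is proportional to one dimer coordinate and `coeffC` to the
  -- product of a trimer coordinate and its two neighbouring dimer coordinates. Hence the one and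
  -- the three logarithmic velocities.
  carrier := {w | ∃ W : ℤ → Fin 3 → 𝕜, Function.Periodic W n ∧ ∀ m,
    W m = coeffA V m • W (m - 1) + coeffB V m • W (m - 2) + coeffC V m • W (m - 3) +
      (coeffB V m * (w (dimer n m) / cornerMap n V (dimer n m))) • V (m - 2) +
      (coeffC V m * (w (trimer n m) / cornerMap n V (trimer n m) +
        w (dimer n m) / cornerMap n V (dimer n m) +
        w (dimer n (m - 1)) / cornerMap n V (dimer n (m - 1)))) • V (m - 3)}
  zero_mem' := ⟨0, fun _ => rfl, fun m => by simp⟩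
  add_mem' := by
    rintro w w' ⟨W, hp, hW⟩ ⟨W', hp', hW'⟩
    refine ⟨W + W', hp.add hp', fun m => ?_⟩
    simp only [Pi.add_apply]
    rw [hW m, hW' m]
    simp only [add_div]
    module
  smul_mem' := by
    rintro c w ⟨W, hp, hW⟩
    refine ⟨c • W, hp.smul c, fun m => ?_⟩
    simp only [Pi.smul_apply, smul_eq_mul]
    rw [hW m]
    simp only [mul_div_assoc]
    module

end CornerMap

/-! ### Analytic arcs of closed polygons from first-order deformations. -/

section Arc

variable {𝕜 : Type*} [RCLike 𝕜] {n : ℕ} [NeZero n]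

theorem hasDerivAt_det₃ (a a' b b' c c' : Fin 3 → 𝕜) :
    HasDerivAt (fun t : 𝕜 => det₃ (a + t • a') (b + t • b') (c + t • c'))
      (det₃ a' b c + det₃ a b' c + det₃ a b c') 0 := by
  have h : ∀ (u u' : Fin 3 → 𝕜) (i : Fin 3), HasDerivAt (fun t : 𝕜 => (u + t • u') i) (u' i) 0 := by
    intro u u' i
    simpa using ((hasDerivAt_id (0 : 𝕜)).mul_const (u' i)).const_add (u i)
  have H := (((h a a' 0).mul (((h b b' 1).mul (h c c' 2)).sub ((h b b' 2).mul (h c c' 1)))).sub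
    ((h a a' 1).mul (((h b b' 0).mul (h c c' 2)).sub ((h b b' 2).mul (h c c' 0))))).add
    ((h a a' 2).mul (((h b b' 0).mul (h c c' 1)).sub ((h b b' 1).mul (h c c' 0))))
  refine H.congr_deriv ?_
  simp [det₃]
  ring

theorem analyticAt_det₃ (a a' b b' c c' : Fin 3 → 𝕜) (s : 𝕜) :
    AnalyticAt 𝕜 (fun t : 𝕜 => det₃ (a + t • a') (b + t • b') (c + t • c')) s := by
  simp only [det₃, Pi.add_apply, Pi.smul_apply, smul_eq_mul]
  fun_prop

section Deformation

variable {V W : ℤ → Fin 3 → 𝕜} {β γ : ℤ → 𝕜}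

/-- The velocities of the coefficients of the recursion under a first-order deformation. -/
theorem hasDerivAt_coeff (hg : IsGeneric V) (m : ℤ)
    (hW : W m = coeffA V m • W (m - 1) + coeffB V m • W (m - 2) + coeffC V m • W (m - 3) +
      β m • V (m - 2) + γ m • V (m - 3)) :
    HasDerivAt (fun t : 𝕜 => coeffA (fun i => V i + t • W i) m) 0 0 ∧
    HasDerivAt (fun t : 𝕜 => coeffB (fun i => V i + t • W i) m) (β m) 0 ∧
    HasDerivAt (fun t : 𝕜 => coeffC (fun i => V i + t • W i) m) (γ m) 0 := by
  have hd := (hg m).1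
  have hV := hg.eq_coeff m
  have h0 := hasDerivAt_det₃ (V (m - 3)) (W (m - 3)) (V (m - 2)) (W (m - 2)) (V (m - 1)) (W (m - 1))
  have hA := hasDerivAt_det₃ (V (m - 3)) (W (m - 3)) (V (m - 2)) (W (m - 2)) (V m) (W m)
  have hB := hasDerivAt_det₃ (V (m - 3)) (W (m - 3)) (V m) (W m) (V (m - 1)) (W (m - 1))
  have hC := hasDerivAt_det₃ (V m) (W m) (V (m - 2)) (W (m - 2)) (V (m - 1)) (W (m - 1))
  have hd' : det₃ (V (m - 3) + (0 : 𝕜) • W (m - 3)) (V (m - 2) + (0 : 𝕜) • W (m - 2))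
    (V (m - 1) + (0 : 𝕜) • W (m - 1)) ≠ 0 := by simpa using hd
  -- The coefficients themselves contain `V m`, so they are made opaque before the recursion is
  -- substituted for `V m`.
  generalize coeffA V m = a at hV hW
  generalize coeffB V m = b at hV hW
  generalize coeffC V m = c at hV hW
  refine ⟨(hA.div h0 hd').congr_deriv ?_, (hB.div h0 hd').congr_deriv ?_,
    (hC.div h0 hd').congr_deriv ?_⟩
  all_goals
    simp only [zero_smul, add_zero]
    rw [div_eq_iff (pow_ne_zero 2 hd), hW, hV]
    generalize V (m - 1) = v₁
    generalize V (m - 2) = v₂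
    generalize V (m - 3) = v₃
    generalize W (m - 1) = w₁
    generalize W (m - 2) = w₂
    generalize W (m - 3) = w₃
    simp only [det₃, Pi.add_apply, Pi.smul_apply, smul_eq_mul]
    ring

theorem analyticAt_coeff (hg : IsGeneric V) (W : ℤ → Fin 3 → 𝕜) (m : ℤ) :
    AnalyticAt 𝕜 (fun t : 𝕜 => coeffA (fun i => V i + t • W i) m) 0 ∧
    AnalyticAt 𝕜 (fun t : 𝕜 => coeffB (fun i => V i + t • W i) m) 0 ∧
    AnalyticAt 𝕜 (fun t : 𝕜 => coeffC (fun i => V i + t • W i) m) 0 := by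
  have hd := (hg m).1
  have hd' : det₃ (V (m - 3) + (0 : 𝕜) • W (m - 3)) (V (m - 2) + (0 : 𝕜) • W (m - 2))
    (V (m - 1) + (0 : 𝕜) • W (m - 1)) ≠ 0 := by simpa using hd
  exact ⟨(analyticAt_det₃ _ _ _ _ _ _ _).div (analyticAt_det₃ _ _ _ _ _ _ _) hd',
    (analyticAt_det₃ _ _ _ _ _ _ _).div (analyticAt_det₃ _ _ _ _ _ _ _) hd',
    (analyticAt_det₃ _ _ _ _ _ _ _).div (analyticAt_det₃ _ _ _ _ _ _ _) hd'⟩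

end Deformation

/-- Each determinant condition is open, and periodicity leaves only finitely many. -/
theorem eventually_isGeneric {V W : ℤ → Fin 3 → 𝕜} (hV : Function.Periodic V n)
    (hW : Function.Periodic W n) (hg : IsGeneric V) :
    ∀ᶠ t : 𝕜 in 𝓝 0, IsGeneric (fun i => V i + t • W i) := by
  have hn : (n : ℤ) ≠ 0 := by exact_mod_cast NeZero.ne n
  have h1 : ∀ a b c : ℤ, det₃ (V a) (V b) (V c) ≠ 0 →
      ∀ᶠ t : 𝕜 in 𝓝 0, det₃ (V a + t • W a) (V b + t • W b) (V c + t • W c) ≠ 0 := by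
    intro a b c h
    refine (hasDerivAt_det₃ _ _ _ _ _ _).continuousAt.eventually_ne ?_
    simpa using h
  have h2 : ∀ᶠ t : 𝕜 in 𝓝 0, ∀ m ∈ Finset.Ico (0 : ℤ) n,
      det₃ (V (m - 3) + t • W (m - 3)) (V (m - 2) + t • W (m - 2))
        (V (m - 1) + t • W (m - 1)) ≠ 0 ∧
      det₃ (V (m - 3) + t • W (m - 3)) (V (m - 2) + t • W (m - 2)) (V m + t • W m) ≠ 0 ∧
      det₃ (V (m - 3) + t • W (m - 3)) (V m + t • W m) (V (m - 1) + t • W (m - 1)) ≠ 0 ∧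
      det₃ (V m + t • W m) (V (m - 2) + t • W (m - 2)) (V (m - 1) + t • W (m - 1)) ≠ 0 := by
    rw [Filter.eventually_all_finset]
    intro m _
    obtain ⟨a, b, c, d⟩ := hg m
    exact (h1 _ _ _ a).and ((h1 _ _ _ b).and ((h1 _ _ _ c).and (h1 _ _ _ d)))
  filter_upwards [h2] with t ht
  intro m
  have key := ht (m % n) (Finset.mem_Ico.2
    ⟨Int.emod_nonneg _ hn, Int.emod_lt_of_pos _ (by omega)⟩)
  have hm : ∀ k, V (m % n - k) = V (m - k) ∧ W (m % n - k) = W (m - k) := by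
    intro k
    have e : m % n - k = m - k - (m / n) * n := by
      have := Int.mul_ediv_add_emod m n
      linear_combination this
    rw [e]
    exact ⟨hV.sub_int_mul_eq _, hW.sub_int_mul_eq _⟩
  have h0 := hm 0
  rw [sub_zero, sub_zero] at h0
  simpa only [(hm 3).1, (hm 3).2, (hm 2).1, (hm 2).2, (hm 1).1, (hm 1).2, h0.1, h0.2] using key

/-- The velocities of periodic deformations are tangent to the space of closed polygons. -/
theorem isTangentAt_of_mem_deformationSpace {V : ℤ → Fin 3 → 𝕜} (hV : Function.Periodic V n)
    (hg : IsGeneric V) {w : ZMod (2 * n) → 𝕜} (hw : w ∈ deformationSpace n V) :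
    IsTangentAt (closedSpace 𝕜 n) (cornerMap n V) w := by
  obtain ⟨W, hWp, hW⟩ := hw
  have hp : ∀ t : 𝕜, Function.Periodic (fun i => V i + t • W i) n := by
    intro t i
    simp only [hV i, hWp i]
  have hz : (fun i => V i + (0 : 𝕜) • W i) = V := by simp
  have hderiv := fun m => hasDerivAt_coeff (β := fun m => coeffB V m *
    (w (dimer n m) / cornerMap n V (dimer n m))) (γ := fun m => coeffC V m *
      (w (trimer n m) / cornerMap n V (trimer n m) + w (dimer n m) / cornerMap n V (dimer n m) +
        w (dimer n (m - 1)) / cornerMap n V (dimer n (m - 1)))) hg m (hW m)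
  have han := fun m => analyticAt_coeff hg W m
  have hA := hg.coeffA_ne_zero
  have hB := hg.coeffB_ne_zero
  have hC := hg.coeffC_ne_zero
  -- The lift moves along a straight line; the corner coordinates are then rational in `t`.
  refine ⟨fun t => cornerMap n (fun i => V i + t • W i), ?_, ?_, ?_, ?_⟩
  · rw [analyticAt_pi_iff]
    intro j
    rcases eq_dimer_or_eq_trimer j with ⟨m, rfl⟩ | ⟨m, rfl⟩
    · simp only [cornerMap_dimer (hp _)]
      refine (han m).2.1.neg.div ((han m).1.mul (han (m - 1)).1) ?_
      simp only [hz]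
      exact mul_ne_zero (hA _) (hA _)
    · simp only [cornerMap_trimer (hp _)]
      refine ((han (m - 1)).1.mul (han m).2.2).div ((han (m - 1)).2.1.mul (han m).2.1) ?_
      simp only [hz]
      exact mul_ne_zero (hB _) (hB _)
  · simp only [hz]
  · filter_upwards [eventually_isGeneric hV hWp hg] with t ht
    exact cornerMap_mem_closedSpace (hp t) ht
  · rw [hasDerivAt_pi]
    intro j
    rcases eq_dimer_or_eq_trimer j with ⟨m, rfl⟩ | ⟨m, rfl⟩
    · simp only [cornerMap_dimer (hp _)]
      refine ((hderiv m).2.1.neg.div ((hderiv m).1.mul (hderiv (m - 1)).1) ?_).congr_deriv ?_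
      · simp only [Pi.mul_apply, hz]
        exact mul_ne_zero (hA _) (hA _)
      · simp only [Pi.mul_apply, Pi.neg_apply, hz, cornerMap_dimer hV]
        have := hA m
        have := hA (m - 1)
        have := hB m
        field_simp
        ring
    · simp only [cornerMap_trimer (hp _)]
      refine (((hderiv (m - 1)).1.mul (hderiv m).2.2).div
        ((hderiv (m - 1)).2.1.mul (hderiv m).2.1) ?_).congr_deriv ?_
      · simp only [Pi.mul_apply, hz]
        exact mul_ne_zero (hB _) (hB _)
      · simp only [Pi.mul_apply, hz]
        have h1 := cornerMap_trimer hV m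
        have h2 := hA (m - 1)
        have h3 := hC m
        have h4 := hB m
        have h5 := hB (m - 1)
        generalize w (dimer n m) / cornerMap n V (dimer n m) = u₁
        generalize w (dimer n (m - 1)) / cornerMap n V (dimer n (m - 1)) = u₂
        rw [h1]
        field_simp
        ring

end Arc

/-! ### The Hamiltonian vector fields as velocities of deformations -/

/-- Each functional on the quotient by `S` yields a scalar polynomial in `l` with infinitely many
roots. The value `l = 1` is exempt because the deformation found below carries the factor `(l -
1)⁻¹`. -/
theorem mem_of_forall_sum_pow_smul_mem {𝕜 E : Type*} [Field 𝕜] [Infinite 𝕜] [AddCommGroup E]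
    [Module 𝕜 E] (S : Submodule 𝕜 E) (e : ℕ → E) (N : ℕ)
    (h : ∀ l : 𝕜, l ≠ 1 → ∑ k ∈ Finset.range N, l ^ k • e k ∈ S) {k : ℕ} (hk : k < N) :
    e k ∈ S := by
  rw [← Submodule.Quotient.mk_eq_zero, ← Module.forall_dual_apply_eq_zero_iff 𝕜]
  intro φ
  let P : Polynomial 𝕜 := ∑ k ∈ Finset.range N, Polynomial.monomial k (φ (S.mkQ (e k)))
  have hP : P = 0 := by
    refine Polynomial.eq_zero_of_infinite_isRoot P
      (Set.Infinite.mono ?_ (Set.finite_singleton (1 : 𝕜)).infinite_compl)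
    intro l hl
    have := congrArg φ ((Submodule.Quotient.mk_eq_zero S).2 (h l hl))
    rw [← Submodule.mkQ_apply, map_sum, map_sum, map_zero] at this
    simp only [Set.mem_ofPred_eq, Polynomial.IsRoot.def, P, Polynomial.eval_finsetSum,
      Polynomial.eval_monomial]
    rw [← this]
    refine Finset.sum_congr rfl fun k _ => ?_
    rw [map_smul, map_smul, smul_eq_mul, mul_comm]
  have hc := congrArg (fun Q => Polynomial.coeff Q k) hP
  simpa [P, Polynomial.finsetSum_coeff, Polynomial.coeff_monomial, hk] using hc

/-! ### The generating Hamiltonian field realized by a periodic deformation. -/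

section Flow

variable {𝕜 : Type*} [Field 𝕜] [CharZero 𝕜] {n : ℕ} [NeZero n]

theorem ringField_dimer (hn : 5 ≤ n) (x : ZMod (2 * n) → 𝕜) (l : 𝕜) (m : ℤ) :
    ringField x l (dimer n m) = x (dimer n m) *
      (ringThrough x l (dimer n (m - 1)) - ringThrough x l (dimer n (m + 1)) +
        ringThrough x l (trimer n (m - 1)) + ringThrough x l (trimer n m) -
        ringThrough x l (trimer n (m + 1)) - ringThrough x l (trimer n (m + 2))) := by
  rw [ringField_of_even hn x l (val_dimer_mod_two m),
    show dimer n m - 3 = trimer n (m - 1) by unfold dimer trimer; push_cast; ring,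
    show dimer n m - 2 = dimer n (m - 1) by unfold dimer; push_cast; ring,
    show dimer n m - 1 = trimer n m by unfold dimer trimer; push_cast; ring,
    show dimer n m + 1 = trimer n (m + 1) by unfold dimer trimer; push_cast; ring,
    show dimer n m + 2 = dimer n (m + 1) by unfold dimer; push_cast; ring,
    show dimer n m + 3 = trimer n (m + 2) by unfold dimer trimer; push_cast; ring]
  ring

theorem ringField_trimer (hn : 5 ≤ n) (x : ZMod (2 * n) → 𝕜) (l : 𝕜) (m : ℤ) :
    ringField x l (trimer n m) = x (trimer n m) *
      (ringThrough x l (trimer n (m + 1)) - ringThrough x l (trimer n (m - 1))) := by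
  rw [ringField_of_odd hn x l (val_trimer_mod_two m),
    show trimer n m - 2 = trimer n (m - 1) by unfold trimer; push_cast; ring,
    show trimer n m + 2 = trimer n (m + 1) by unfold trimer; push_cast; ring]

theorem ringWeight_dimer (x : ZMod (2 * n) → 𝕜) (m : ℤ) :
    ringWeight x (dimer n m) = -x (dimer n m) := by
  rw [ringWeight, val_dimer_mod_two, if_neg zero_ne_one]

theorem ringWeight_trimer (x : ZMod (2 * n) → 𝕜) (m : ℤ) :
    ringWeight x (trimer n m) = x (dimer n (m - 1)) * x (trimer n m) * x (dimer n m) := by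
  rw [ringWeight, val_trimer_mod_two, if_pos rfl,
    show trimer n m - 1 = dimer n (m - 1) by unfold dimer trimer; push_cast; ring,
    show trimer n m + 1 = dimer n m by unfold dimer trimer; push_cast; ring]

/-- The tile weights are the coefficients of the recursion normalized to have leading coefficient 1.
-/
theorem coeffB_eq_ringWeight {V : ℤ → Fin 3 → 𝕜} (hV : Function.Periodic V n)
    (hg : IsGeneric V) (m : ℤ) :
    coeffB V m = coeffA V m * coeffA V (m - 1) * ringWeight (cornerMap n V) (dimer n m) := by
  have h1 := hg.coeffA_ne_zero m
  have h2 := hg.coeffA_ne_zero (m - 1)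
  rw [ringWeight_dimer, cornerMap_dimer hV]
  field_simp

theorem coeffC_eq_ringWeight {V : ℤ → Fin 3 → 𝕜} (hV : Function.Periodic V n)
    (hg : IsGeneric V) (m : ℤ) :
    coeffC V m = coeffA V m * coeffA V (m - 1) * coeffA V (m - 2) *
      ringWeight (cornerMap n V) (trimer n m) := by
  have h1 := hg.coeffA_ne_zero m
  have h2 := hg.coeffA_ne_zero (m - 1)
  have h3 := hg.coeffA_ne_zero (m - 2)
  have h4 := hg.coeffB_ne_zero m
  have h5 := hg.coeffB_ne_zero (m - 1)
  rw [ringWeight_trimer, cornerMap_dimer hV, cornerMap_dimer hV, cornerMap_trimer hV,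
    show m - 1 - 1 = m - 2 by ring]
  field_simp

theorem ringField_mem_deformationSpace (hn : 5 ≤ n) {V : ℤ → Fin 3 → 𝕜}
    (hV : Function.Periodic V n) (hg : IsGeneric V) {l : 𝕜} (hl : l ≠ 1) :
    ringField (cornerMap n V) l ∈ deformationSpace n V := by
  have hx := cornerMap_ne_zero hV hg
  have hBp := coeffB_eq_ringWeight hV hg
  have hCq := coeffC_eq_ringWeight hV hg
  have hrec := hg.eq_coeff
  have ha := hg.coeffA_ne_zero
  have haper := coeffA_periodic hV
  set x := cornerMap n V with hxdef
  set a := coeffA V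
  let w : ZMod (2 * n) → 𝕜 := fun i => l * ringWeight x i
  let p : ℤ → 𝕜 := fun m => ringWeight x (dimer n m)
  let q : ℤ → 𝕜 := fun m => ringWeight x (trimer n m)
  -- `I s k` belongs to the chain of `n - s` cells after the cell `k`.
  let I : ℤ → ℤ → 𝕜 := fun s k => intervalSum w k (k + n - s)
  let P : ℤ → 𝕜 := fun m => ringThrough x l (dimer n m)
  let Q : ℤ → 𝕜 := fun m => ringThrough x l (trimer n m)
  let A : ℤ → 𝕜 := fun k => I 1 k + P k + Q k
  let B : ℤ → 𝕜 := fun k => l * (p (k + 1) * I 1 (k + 1) + q (k + 2) * I 2 (k + 2))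
  let G : ℤ → 𝕜 := fun k => l * q (k + 1) * I 1 (k + 1)
  have hI : ∀ s k, I s (k + n) = I s k := by
    intro s k
    simp only [I]
    rw [show k + (n : ℤ) + n - s = k + n - s + n by ring, intervalSum_add_period]
  have hp : ∀ k, p (k + n) = p k := fun k => by simp only [p, dimer_add_period]
  have hq : ∀ k, q (k + n) = q k := fun k => by simp only [q, trimer_add_period]
  have hPP : ∀ k, P (k + n) = P k := fun k => by simp only [P, dimer_add_period]
  have hQQ : ∀ k, Q (k + n) = Q k := fun k => by simp only [Q, trimer_add_period]
  have hP : ∀ k, P k = l * p k * I 2 k := fun k => packingSumThrough_dimer w k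
  have hQ : ∀ k, Q k = l * q k * I 3 k := fun k => packingSumThrough_trimer w k
  -- For `s = 2` the chain must still have room for a trimer, that is `n - 2 ≥ 3`.
  have hright : ∀ k s : ℤ, 1 ≤ s → s ≤ 2 →
      I s k = I (s + 1) k + l * p (k - s) * I (s + 2) k + l * q (k - s) * I (s + 3) k := by
    intro k s h1 h2
    have h := intervalSum_eq_right hn w (a := k) (b := k + n - s) (by omega) (by omega)
    rw [show k + (n : ℤ) - s = k - s + n by ring, dimer_add_period, trimer_add_period,
      show k - s + (n : ℤ) - 1 = k + n - (s + 1) by ring,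
      show k - s + (n : ℤ) - 2 = k + n - (s + 2) by ring,
      show k - s + (n : ℤ) - 3 = k + n - (s + 3) by ring,
      show k - s + (n : ℤ) = k + n - s by ring] at h
    exact h
  have hleft : ∀ k s : ℤ, 1 ≤ s → s ≤ 2 →
      I s k = I (s + 1) (k + 1) + l * p (k + 2) * I (s + 2) (k + 2) +
        l * q (k + 3) * I (s + 3) (k + 3) := by
    intro k s h1 h2
    have h := intervalSum_eq_left hn w (a := k) (b := k + n - s) (by omega) (by omega)
    simp only [I]
    rw [show k + 1 + (n : ℤ) - (s + 1) = k + n - s by ring,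
      show k + 2 + (n : ℤ) - (s + 2) = k + n - s by ring,
      show k + 3 + (n : ℤ) - (s + 3) = k + n - s by ring]
    exact h
  have hl' : l - 1 ≠ 0 := sub_ne_zero.2 hl
  -- The combination from `deformation_identity`, with the rescaling by `a` undone and the factor
  -- `-(l - 1)` divided out. Each ingredient is periodic, hence so is the sum.
  refine ⟨fun m => -(l - 1)⁻¹ • (A m • V m + (a m * B m) • V (m - 1) +
    (a m * a (m - 1) * G m) • V (m - 2)), ?_, ?_⟩
  · intro m
    simp only [A, B, G]
    rw [show m + (n : ℤ) - 1 = m - 1 + n by ring, show m + (n : ℤ) - 2 = m - 2 + n by ring,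
      show m + (n : ℤ) + 1 = m + 1 + n by ring, show m + (n : ℤ) + 2 = m + 2 + n by ring]
    simp only [hI, hp, hq, hPP, hQQ, hV _, haper _]
  · intro m
    have e1 : ∀ k, ringField x l (dimer n k) / x (dimer n k) =
        P (k - 1) - P (k + 1) + Q (k - 1) + Q k - Q (k + 1) - Q (k + 2) := by
      intro k
      rw [ringField_dimer hn, mul_div_cancel_left₀ _ (hx _)]
    have e2 : ∀ k, ringField x l (trimer n k) / x (trimer n k) = Q (k + 1) - Q (k - 1) := by
      intro k
      rw [ringField_trimer hn, mul_div_cancel_left₀ _ (hx _)]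
    rw [e1, e1, e2, hBp, hCq]
    change _ = _ + (a m * a (m - 1) * p m * _) • _ +
      (a m * a (m - 1) * a (m - 2) * q m * _) • _
    ext i
    -- The running product of the `a`'s need not be periodic, so the rescaling is local: six
    -- consecutive vectors, normalized at `V (m - 1)`. Six are needed as the recursion reaches back
    -- three steps and `W` two more.
    have key := deformation_identity l (packingSum ringCells w Finset.univ) p q (I 1) (I 2) (I 3)
      (I 4) (I 5) P Q (packingSum_univ_eq hn w) hP hQ
      (fun k => hright k 1 le_rfl one_le_two) (fun k => hright k 2 one_le_two le_rfl)
      (fun k => hleft k 1 le_rfl one_le_two) (fun k => hleft k 2 one_le_two le_rfl)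
      A B G (fun _ => rfl) (fun _ => rfl) (fun _ => rfl) m
      ((a m)⁻¹ * V m i) (V (m - 1) i) (a (m - 1) * V (m - 2) i)
      (a (m - 1) * a (m - 2) * V (m - 3) i) (a (m - 1) * a (m - 2) * a (m - 3) * V (m - 4) i)
      (a (m - 1) * a (m - 2) * a (m - 3) * a (m - 4) * V (m - 5) i) ?_ ?_ ?_
    · simp only [Pi.add_apply, Pi.smul_apply, smul_eq_mul]
      rw [show m - 1 - 1 = m - 2 by ring, show m - 1 - 2 = m - 3 by ring,
        show m - 2 - 1 = m - 3 by ring, show m - 2 - 2 = m - 4 by ring,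
        show m - 3 - 1 = m - 4 by ring, show m - 3 - 2 = m - 5 by ring,
        show m - 1 + 1 = m by ring, show m - 1 + 2 = m + 1 by ring]
      have ham := ha m
      field_simp at key ⊢
      linear_combination -key
    · have h := congrFun (hrec m) i
      simp only [Pi.add_apply, Pi.smul_apply, smul_eq_mul] at h
      rw [h, hBp, hCq]
      have ham := ha m
      change _ = _ + p m * _ + q m * _
      simp only [p, q]
      field_simp
    · have h := congrFun (hrec (m - 1)) i
      simp only [Pi.add_apply, Pi.smul_apply, smul_eq_mul] at h
      rw [h, hBp, hCq, show m - 1 - 1 = m - 2 by ring, show m - 1 - 2 = m - 3 by ring,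
        show m - 1 - 3 = m - 4 by ring]
      simp only [p, q]
      ring
    · have h := congrFun (hrec (m - 2)) i
      simp only [Pi.add_apply, Pi.smul_apply, smul_eq_mul] at h
      rw [h, hBp, hCq, show m - 2 - 1 = m - 3 by ring, show m - 2 - 2 = m - 4 by ring,
        show m - 2 - 3 = m - 5 by ring]
      simp only [p, q]
      ring

theorem hamiltonianVectorField_mem_deformationSpace (hn : 5 ≤ n) {V : ℤ → Fin 3 → 𝕜}
    (hV : Function.Periodic V n) (hg : IsGeneric V) {k : ℕ} (hk : k ≤ 2 * n) :
    hamiltonianVectorField (admissibleSum 𝕜 n 1 k) (cornerMap n V) ∈ deformationSpace n V :=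
  mem_of_forall_sum_pow_smul_mem (deformationSpace n V)
    (fun k => hamiltonianVectorField (admissibleSum 𝕜 n 1 k) (cornerMap n V)) (2 * n + 1)
    (fun _ hl => ringField_mem_deformationSpace hn hV hg hl) (Nat.lt_succ_of_le hk)

end Flow

theorem isTangentAt_hamiltonianVectorField_even {𝕜 : Type*} [RCLike 𝕜] {n : ℕ} [NeZero n]
    (hn : 5 ≤ n) {k : ℕ} (hk : k ≤ 2 * n) {x : ZMod (2 * n) → 𝕜} (hx : x ∈ closedSpace 𝕜 n) :
    IsTangentAt (closedSpace 𝕜 n) x (hamiltonianVectorField (admissibleSum 𝕜 n 1 k) x) := by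
  obtain ⟨V, hV, hg, rfl⟩ := exists_lift_of_mem_closedSpace hx
  exact isTangentAt_of_mem_deformationSpace hV hg
    (hamiltonianVectorField_mem_deformationSpace hn hV hg hk)

/-! ### Reversal of the orientation of a polygon -/

section Reversal

variable {𝕜 : Type*} [Field 𝕜] {n : ℕ} [NeZero n]

/-- The action on the indices of corner invariants of the reversal of a polygon. -/
def reversal (n : ℕ) : ZMod (2 * n) ≃ ZMod (2 * n) := Equiv.subLeft (-1)

theorem reversal_apply (j : ZMod (2 * n)) : reversal n j = -1 - j := rfl

theorem reversal_reversal (j : ZMod (2 * n)) : reversal n (reversal n j) = j := by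
  simp only [reversal_apply]; ring

theorem val_reversal_mod_two (j : ZMod (2 * n)) : (reversal n j).val % 2 = (j.val + 1) % 2 := by
  have h1 := val_add_mod_two (reversal n j) (j + 1)
  have h2 := val_add_one_mod_two j
  rw [reversal_apply] at *
  rw [show -1 - j + (j + 1) = 0 by ring, ZMod.val_zero] at h1
  omega

theorem paritySign_reversal (j : ZMod (2 * n)) : paritySign (reversal n j) = -paritySign j := by
  have h := val_reversal_mod_two j
  rcases Nat.mod_two_eq_zero_or_one j.val with hj | hj
  · rw [paritySign_of_even hj, paritySign_of_odd (by omega)]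
  · rw [paritySign_of_odd hj, paritySign_of_even (by omega), neg_neg]

/-- Reversal flips the parity and exchanges the shifts 2 and -2; the two signs cancel, so it
preserves the bracket. -/
theorem bracketCoeff_reversal (h4 : (4 : ZMod (2 * n)) ≠ 0) (i j : ZMod (2 * n)) :
    bracketCoeff (reversal n i) (reversal n j) = bracketCoeff i j := by
  rw [bracketCoeff_eq h4, bracketCoeff_eq h4, paritySign_reversal]
  have h1 : reversal n i = reversal n j - 2 ↔ i = j + 2 := by
    simp only [reversal_apply]
    constructor <;> intro h <;> linear_combination -h
  have h2 : reversal n i = reversal n j + 2 ↔ i = j - 2 := by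
    simp only [reversal_apply]
    constructor <;> intro h <;> linear_combination -h
  simp only [h1, h2]
  ring

theorem poissonBracket_rename_reversal (h4 : (4 : ZMod (2 * n)) ≠ 0)
    (f g : MvPolynomial (ZMod (2 * n)) 𝕜) :
    poissonBracket (MvPolynomial.rename (reversal n) f) (MvPolynomial.rename (reversal n) g) =
      MvPolynomial.rename (reversal n) (poissonBracket f g) := by
  unfold poissonBracket
  rw [map_sum, ← Equiv.sum_comp (reversal n)]
  refine Finset.sum_congr rfl fun i _ => ?_
  rw [map_sum, ← Equiv.sum_comp (reversal n)]
  refine Finset.sum_congr rfl fun j _ => ?_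
  rw [bracketCoeff_reversal h4, MvPolynomial.pderiv_rename (reversal n).injective,
    MvPolynomial.pderiv_rename (reversal n).injective]
  simp

theorem elementaryMonomial_reversal (i : ZMod (2 * n)) :
    elementaryMonomial 𝕜 0 (reversal n i) =
      MvPolynomial.rename (reversal n) (elementaryMonomial 𝕜 1 i) := by
  have h := val_reversal_mod_two i
  unfold elementaryMonomial
  by_cases hi : i.val % 2 = 1
  · rw [if_pos (by omega), if_pos hi]
    simp only [map_mul, MvPolynomial.rename_X]
    rw [show reversal n (i - 1) = reversal n i + 1 by simp only [reversal_apply]; ring,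
      show reversal n (i + 1) = reversal n i - 1 by simp only [reversal_apply]; ring]
    ring
  · rw [if_neg (by omega), if_neg hi, MvPolynomial.rename_X]

theorem isAdmissible_map_reversal (h4 : (4 : ZMod (2 * n)) ≠ 0) (S : Finset (ZMod (2 * n))) :
    IsAdmissible 𝕜 0 (S.map (reversal n).toEmbedding) ↔ IsAdmissible 𝕜 1 S := by
  unfold IsAdmissible
  simp only [Finset.forall_mem_map, Equiv.coe_toEmbedding, elementaryMonomial_reversal,
    poissonBracket_rename_reversal h4]
  refine forall₄_congr fun i _ j _ => ?_
  exact map_eq_zero_iff _ (MvPolynomial.rename_injective _ (reversal n).injective)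

/-- Reversal exchanges the parities, hence the two families of elementary monomials, and it
preserves admissibility because it preserves the bracket. -/
theorem admissibleSum_zero_eq_rename (h4 : (4 : ZMod (2 * n)) ≠ 0) (k : ℕ) :
    admissibleSum 𝕜 n 0 k = MvPolynomial.rename (reversal n) (admissibleSum 𝕜 n 1 k) := by
  unfold admissibleSum
  rw [map_sum]
  symm
  refine Finset.sum_equiv (reversal n).finsetCongr (fun S => ?_) (fun S _ => ?_)
  · simp only [Finset.mem_filter, Equiv.finsetCongr_apply, isAdmissible_map_reversal h4]
    simp
  · rw [Equiv.finsetCongr_apply, Finset.prod_map, map_mul, map_prod, Finset.filter_map,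
      Finset.card_map, map_pow, map_neg, map_one]
    simp only [Equiv.coe_toEmbedding, elementaryMonomial_reversal]
    congr 3
    refine Finset.filter_congr fun i _ => ?_
    have h := val_reversal_mod_two i
    simp only [Function.comp_apply]
    omega

theorem hamiltonianVectorField_rename_reversal (h4 : (4 : ZMod (2 * n)) ≠ 0)
    (f : MvPolynomial (ZMod (2 * n)) 𝕜) (x : ZMod (2 * n) → 𝕜) (j : ZMod (2 * n)) :
    hamiltonianVectorField (MvPolynomial.rename (reversal n) f) x j =
      hamiltonianVectorField f (x ∘ reversal n) (reversal n j) := by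
  unfold hamiltonianVectorField
  have h : (MvPolynomial.X j : MvPolynomial (ZMod (2 * n)) 𝕜) =
      MvPolynomial.rename (reversal n) (MvPolynomial.X (reversal n j)) := by
    rw [MvPolynomial.rename_X, reversal_reversal]
  rw [h, poissonBracket_rename_reversal h4, MvPolynomial.eval_rename]

theorem independent_reverse {p q r : ℙ 𝕜 (Fin 3 → 𝕜)}
    (h : Projectivization.Independent ![p, q, r]) :
    Projectivization.Independent ![r, q, p] := by
  rw [Projectivization.independent_iff] at h ⊢
  have := h.comp ![2, 1, 0] (by decide)
  convert this using 1
  ext l : 1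
  fin_cases l <;> rfl

/-- The witness is `i ↦ v (-i)`: the formulas for odd and even corner invariants are mirror images,
so the index `2 i` becomes `-2 i - 1`. -/
theorem comp_reversal_mem_closedSpace {x : ZMod (2 * n) → 𝕜} (hx : x ∈ closedSpace 𝕜 n) :
    x ∘ reversal n ∈ closedSpace 𝕜 n := by
  obtain ⟨v, hv, hg, hx⟩ := hx
  refine ⟨fun i => v (-i), fun i => ?_, fun i => ?_, fun i => ?_⟩
  · have := hv (-(i + n))
    rw [show -(i + (n : ℤ)) + n = -i by ring] at this
    rw [one_smul] at this ⊢
    exact this.symm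
  · obtain ⟨h1, h2, h3, h4⟩ := hg (-i - 3)
    rw [show -i - 3 = -(i + 3) by ring, show -(i + 3) + 1 = -(i + 2) by ring,
      show -(i + 3) + 2 = -(i + 1) by ring, show -(i + 3) + 3 = -i by ring] at *
    exact ⟨independent_reverse h4, independent_reverse h3, independent_reverse h2,
      independent_reverse h1⟩
  · obtain ⟨h1, h2⟩ := hx (-i)
    rw [show -i - 2 = -(i + 2) by ring, show -i - 1 = -(i + 1) by ring,
      show -i + 1 = -(i - 1) by ring, show -i + 2 = -(i - 2) by ring] at h1 h2
    have e1 : reversal n ((2 * i - 1 : ℤ) : ZMod (2 * n)) = ((2 * -i : ℤ) : ZMod (2 * n)) := by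
      rw [reversal_apply]; push_cast; ring
    have e2 : reversal n ((2 * i : ℤ) : ZMod (2 * n)) = ((2 * -i - 1 : ℤ) : ZMod (2 * n)) := by
      rw [reversal_apply]; push_cast; ring
    simp only [Function.comp_apply, e1, e2]
    exact ⟨h2, h1⟩

end Reversal

theorem isTangentAt_hamiltonianVectorField_odd {𝕜 : Type*} [RCLike 𝕜] {n : ℕ} [NeZero n]
    (hn : 5 ≤ n) {k : ℕ} (hk : k ≤ 2 * n) {x : ZMod (2 * n) → 𝕜} (hx : x ∈ closedSpace 𝕜 n) :
    IsTangentAt (closedSpace 𝕜 n) x (hamiltonianVectorField (admissibleSum 𝕜 n 0 k) x) := by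
  have h4 : (4 : ZMod (2 * n)) ≠ 0 := by
    exact_mod_cast ofNat_ne_zero_of_lt (n := n) (k := 4) (by omega) (by omega)
  obtain ⟨γ, hγ, h0, hmem, hd⟩ :=
    isTangentAt_hamiltonianVectorField_even hn hk (comp_reversal_mem_closedSpace hx)
  refine ⟨fun t => γ t ∘ reversal n, ?_, ?_, ?_, ?_⟩
  · rw [analyticAt_pi_iff] at hγ ⊢
    exact fun j => hγ _
  · simp only [h0]
    funext j
    simp only [Function.comp_apply, reversal_reversal]
  · filter_upwards [hmem] with t ht
    exact comp_reversal_mem_closedSpace ht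
  · rw [hasDerivAt_pi] at hd ⊢
    intro j
    rw [admissibleSum_zero_eq_rename h4, hamiltonianVectorField_rename_reversal h4]
    exact hd _

theorem isTangentAt_zero {𝕜 : Type*} [RCLike 𝕜] {ι : Type*} [Fintype ι] {S : Set (ι → 𝕜)}
    {x : ι → 𝕜} (hx : x ∈ S) : IsTangentAt S x 0 :=
  ⟨fun _ => x, analyticAt_const, rfl, Filter.Eventually.of_forall fun _ => hx,
    hasDerivAt_const _ _⟩

end Pentagram

end

/-! ### Tangency for all monodromy invariants. -/

theorem mainTheorem4 {𝕜 : Type*} [RCLike 𝕜] (n : ℕ) [NeZero n] (hn : 5 ≤ n)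
    (F : MvPolynomial (ZMod (2 * n)) 𝕜) (hF : Pentagram.IsMonodromyInvariant F)
    (x : ZMod (2 * n) → 𝕜) (hx : x ∈ Pentagram.closedSpace 𝕜 n) :
    Pentagram.IsTangentAt (Pentagram.closedSpace 𝕜 n) x
      (Pentagram.hamiltonianVectorField F x) := by
  have h4 : (4 : ZMod (2 * n)) ≠ 0 := by
    exact_mod_cast Pentagram.ofNat_ne_zero_of_lt (n := n) (k := 4) (by omega) (by omega)
  cases hF with
  | O k hk hk' => exact Pentagram.isTangentAt_hamiltonianVectorField_odd hn (by omega) hx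
  | E k hk hk' => exact Pentagram.isTangentAt_hamiltonianVectorField_even hn (by omega) hx
  | On =>
    rw [Pentagram.oddProduct, Pentagram.hamiltonianVectorField_parityProduct h4]
    exact Pentagram.isTangentAt_zero hx
  | En =>
    rw [Pentagram.evenProduct, Pentagram.hamiltonianVectorField_parityProduct h4]
    exact Pentagram.isTangentAt_zero hx
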